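/- Conventions. All hypergraphs are finite and simple: a hypergraph $\mathcal G=(V,E)$ has a nonempty finite vertex set $V$ and a set $E$ of subsets of $V$, each with at least two elements. Its order is $|V|$, and it is $k$-uniform if $|e|=k$ for every $e\in E$. A hyperpath of length $q\ge 0$ from $v_1$ to $v_{q+1}$ is a sequence $v_1e_1v_2e_2\cdots v_qe_qv_{q+1}$ of distinct vertices $v_i$ and distinct edges $e_i$ such that $v_i,v_{i+1}\in e_i$ for $1\le i\le q$, $e_i\cap e_{i+1}=\{v_{i+1}\}$ for $1\le i\le q-1$, and $e_i\cap e_j=\emptyset$ whenever $|i-j|\ge 2$. A hypercycle of length $q\ge 2$ consists of a hyperpath $v_1e_1v_2\cdots e_{q-1}v_q$ and a further edge $e_q\notin\{e_1,\dots,e_{q-1}\}$ with $v_1,v_q\in e_q$ such that, if $q\ge 3$, $e_q\cap e_1=\{v_1\}$, $e_q\cap e_{q-1}=\{v_q\}$ and $e_q\cap e_j=\emptyset$ for $1<j<q-1$; thus a hypercycle of length $2$ is a pair of distinct edges sharing at least two vertices. A supertree is a hypergraph in which any two vertices are joined by a hyperpath and which contains no hypercycle. The order of a $k$-uniform supertree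 ($k\ge 2$) has the form $n=m(k-1)+1$, where $m\geq 0$ is its number of edges. For such $n$, $\mathcal P(n,k)$ denotes the $k$-uniform hyperpath of order $n$, that is, the hypergraph with vertices $0,1,\dots,n-1$ and edges $\{i(k-1),i(k-1)+1,\dots,(i+1)(k-1)\}$ for $0\le i<m$. Two hypergraphs are isomorphic ($\cong$) if there is a bijection between their vertex sets that maps the edges of the one exactly onto the edges of the other. The spectral radius $\rho(\mathcal G)$ is the maximum modulus of the eigenvalues of the adjacency matrix $\mathcal A_{\mathcal G}$, which is indexed by $V$ and has entries $(\mathcal A_{\mathcal G})_{ij}=\sum_{e\in E,\ i,j\in e}\frac{1}{|e|-1}$ for $i\ne j$ and $(\mathcal A_{\mathcal G})_{ii}=0$. Theorem. Let $k\ge 3$ and let $\mathcal G$ be a $k$-uniform supertree of order $n$. Then $$\rho(\mathcal P(n,k))\le\rho(\mathcal G),$$ with equality if and only if $\mathcal G\cong\mathcal P(n,k)$. -/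

import Mathlib

namespace Hypergraph

/-- Every edge has exactly `k` vertices. -/
def IsUniform {α : Type*} (H : Hypergraph α) (k : ℕ) : Prop :=
  ∀ e ∈ H.edgeSet, e.ncard = k

/-- `v 0, e 0, v 1, e 1, …, v (q - 1), e (q - 1), v q` is a hyperpath of length `q` in `H`: distinct
vertices, distinct edges, consecutive edges meet exactly in the vertex between them, and
non-consecutive edges are disjoint. Only the values `v i` with `i ≤ q` and `e i` with `i < q` matter.
A single vertex is a hyperpath of length `0`. -/
structure IsHyperpath {α : Type*} (H : Hypergraph α) (q : ℕ) (v : ℕ → α) (e : ℕ → Set α) :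
    Prop where
  vertex_mem : ∀ i ≤ q, v i ∈ H.vertexSet
  edge_mem : ∀ i < q, e i ∈ H.edgeSet
  vertex_inj : Set.InjOn v (Set.Iic q)
  edge_inj : Set.InjOn e (Set.Iio q)
  left_mem : ∀ i < q, v i ∈ e i
  right_mem : ∀ i < q, v (i + 1) ∈ e i
  inter_eq : ∀ i, i + 1 < q → e i ∩ e (i + 1) = {v (i + 1)}
  disjoint : ∀ i j, i + 2 ≤ j → j < q → Disjoint (e i) (e j)

/-- A hypercycle of length `p + 1 ≥ 2` in `H`: a hyperpath `v 0, e 0, v 1, …, e (p - 1), v p`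
together with a further edge `e p` that joins `v p` to `v 0`, meets `e (p - 1)` only in `v p`, meets
`e 0` only in `v 0` and is disjoint from all other edges of the hyperpath. For `p = 1` the edges
`e 0` and `e (p - 1)` coincide, and a hypercycle consists of two distinct edges that share the two
distinct vertices `v 0` and `v 1`. -/
structure IsHypercycle {α : Type*} (H : Hypergraph α) (p : ℕ) (v : ℕ → α) (e : ℕ → Set α) :
    Prop where
  one_le : 1 ≤ p
  path : H.IsHyperpath p v e
  last_mem : e p ∈ H.edgeSet
  last_ne : ∀ i < p, e p ≠ e i
  first_vertex_mem : v 0 ∈ e p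
  last_vertex_mem : v p ∈ e p
  inter_first : 2 ≤ p → e p ∩ e 0 = {v 0}
  inter_last : 2 ≤ p → e p ∩ e (p - 1) = {v p}
  disjoint : ∀ j, 0 < j → j < p - 1 → Disjoint (e p) (e j)

/-- Any two vertices are joined by a hyperpath. -/
def IsConnected {α : Type*} (H : Hypergraph α) : Prop :=
  ∀ x ∈ H.vertexSet, ∀ y ∈ H.vertexSet,
    ∃ (q : ℕ) (v : ℕ → α) (e : ℕ → Set α), H.IsHyperpath q v e ∧ v 0 = x ∧ v q = y

/-- There is no hypercycle. -/
def IsAcyclic {α : Type*} (H : Hypergraph α) : Prop :=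
  ∀ (p : ℕ) (v : ℕ → α) (e : ℕ → Set α), ¬ H.IsHypercycle p v e

/-- A supertree: a connected acyclic hypergraph with a nonempty vertex set. -/
structure IsSupertree {α : Type*} (H : Hypergraph α) : Prop where
  nonempty : H.vertexSet.Nonempty
  connected : H.IsConnected
  acyclic : H.IsAcyclic

/-- Two hypergraphs are isomorphic: some bijection of the vertex sets carries the edges of the one
exactly to the edges of the other. -/
def IsIsomorphic {α β : Type*} (G : Hypergraph α) (H : Hypergraph β) : Prop :=
  ∃ f : G.vertexSet ≃ H.vertexSet, ∀ s : Set G.vertexSet,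
    (Subtype.val '' s ∈ G.edgeSet ↔ Subtype.val '' (f '' s) ∈ H.edgeSet)

open Classical in
/-- The adjacency matrix of a hypergraph: zero on the diagonal, and the entry at `i ≠ j` is the sum
of `1 / (|e| - 1)` over all edges `e` that contain both `i` and `j` (there are finitely many edges
when there are finitely many vertices). -/
noncomputable def adjMatrix {α : Type*} (H : Hypergraph α) :
    Matrix H.vertexSet H.vertexSet ℝ :=
  Matrix.of fun i j =>
    if i = j then 0
    else ∑ᶠ e ∈ {e : Set α | e ∈ H.edgeSet ∧ (i : α) ∈ e ∧ (j : α) ∈ e},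
      1 / ((e.ncard : ℝ) - 1)

open Classical in
/-- The spectral radius of a finite hypergraph: the maximum modulus of the complex eigenvalues of
its adjacency matrix. -/
noncomputable def rho {α : Type*} (H : Hypergraph α) [Fintype H.vertexSet] : ENNReal :=
  spectralRadius ℂ (H.adjMatrix.map Complex.ofReal)

/-- The `k`-uniform hyperpath of order `n` (for `k ≥ 2` and `n = m (k - 1) + 1`): its vertices are
`0, 1, …, n - 1` and its `m` edges are the sets of `k` consecutive vertices
`{i (k - 1), …, (i + 1) (k - 1)}`, `0 ≤ i < m`. -/
def hyperpath (n k : ℕ) : Hypergraph ℕ where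
  vertexSet := Set.Iio n
  edgeSet := {e | ∃ i : ℕ, (i + 1) * (k - 1) < n ∧
    e = Set.Icc (i * (k - 1)) ((i + 1) * (k - 1))}
  subset_vertexSet_of_mem_edgeSet' := by
    rintro e ⟨i, hi, rfl⟩ x hx
    exact lt_of_le_of_lt hx.2 hi

instance fintypeHyperpathVertexSet (n k : ℕ) : Fintype (hyperpath n k).vertexSet :=
  inferInstanceAs (Fintype (Set.Iio n))

end Hypergraph

/-! It suffices to show that ρ(G) ≤ ρ(P) forces G ≅ P, where P is the hyperpath: the order on
spectral radii is total and ρ is invariant under isomorphism. Let lam = (k - 1)ρ(P), L = lam + 1, K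
= k - 2, and let y be a positive eigenvector of G. Then the neighbour sum of y at every vertex u is
at most lam · y u.

Each branch of G is compared with a branch of P having equally many edges. In P, a branch with j
edges contributes `ratioH j` times the entry at its end vertex to the neighbour sum there, and that
vertex holds the share `ratioT j` of the next edge sum. Joining two branches into one never
increases these ratios, and strictly decreases them when both branches are nonempty and the path
goes on beyond them (`ratioH_add_le_lt`, `ratioT_add_le_lt`). This follows from a Wronskian-type
identity between a profile and its shift (`cross_eq`), together with the symmetry and unimodality of
the eigenvector of P.

Pruning G from its leaves therefore preserves an inequality in which every pruned branch counts as a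
path branch with the same number of edges (`exists_weights`). If the pruning stops at three edges
sharing a vertex, or at an edge with three branching vertices, the strict inequality contradicts the
equation of P itself (`ratioH_last`, `ratioT_last`). So G does not branch, a longest trail covers
it, and numbering the vertices along the trail gives the isomorphism. -/

/-! ### Path profiles: symmetry, unimodality and subadditive ratios -/

/-- The entries `w` at the cut vertices and the edge sums `T` of a positive eigenvector of a
hyperpath with `m` edges; `T (j + 1)` belongs to the edge between the cut vertices `j`, `j + 1`. -/
structure PathProfile (m : ℕ) (K L b : ℝ) (w T : ℕ → ℝ) : Prop where
  K_nonneg : 0 ≤ K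
  L_pos : 0 < L
  b_mul : b * L = L - K
  w_pos : ∀ j ≤ m, 0 < w j
  T_pos : ∀ j ≤ m + 1, 0 < T j
  T_zero : T 0 = w 0
  T_last : T (m + 1) = w m
  vertex_eq : ∀ j ≤ m, T j + T (j + 1) = (L + 1) * w j
  edge_eq : ∀ j < m, w j + w (j + 1) = b * T (j + 1)

/-- Reflecting an index beyond the middle reduces every comparison to the increasing half. The
condition a + b ≤ M says that b is at least as far from the centre as a. -/
theorem symm_unimodal {M : ℕ} {z : ℕ → ℝ} (hs : ∀ i ≤ M, z (M - i) = z i)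
    (hinc : ∀ i, 2 * i + 1 < M → z i < z (i + 1)) :
    (∀ a b, b ≤ a → a + b ≤ M → z b ≤ z a) ∧ ∀ c, 0 < c → c < M → z 0 < z c := by
  have key : ∀ d b, 0 < d → 2 * (b + d) ≤ M → z b < z (b + d) := by
    intro d
    induction d with
    | zero => intro b h; omega
    | succ d ih =>
      intro b _ h
      have h1 := hinc (b + d) (by omega)
      rcases Nat.eq_zero_or_pos d with rfl | hd
      · simpa using h1
      · exact (ih b hd (by omega)).trans h1
  have key' : ∀ a b, b < a → a + b < M → z b < z a := by
    intro a b hba hab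
    rcases le_total (2 * a) M with h | h
    · have := key (a - b) b (by omega) (by omega)
      rwa [Nat.add_sub_cancel' hba.le] at this
    · rw [← hs a (by omega)]
      have := key (M - a - b) b (by omega) (by omega)
      rwa [Nat.add_sub_cancel' (by omega)] at this
  refine ⟨fun a b hba hab => ?_, fun c hc hcM => key' c 0 hc (by omega)⟩
  rcases hba.eq_or_lt with rfl | hba
  · rfl
  rcases hab.eq_or_lt with h | h
  · rw [← hs a (by omega), show M - a = b by omega]
  · exact (key' a b hba h).le

namespace PathProfile

variable {m : ℕ} {K L b : ℝ} {w T : ℕ → ℝ}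

/-- The neighbour sum at the end of a branch with `j` edges, relative to the entry there. -/
noncomputable def ratioH (w T : ℕ → ℝ) (j : ℕ) : ℝ := (T j - w j) / w j

/-- The entry at the end of a branch with `j` edges, relative to the sum over the next edge. -/
noncomputable def ratioT (w T : ℕ → ℝ) (j : ℕ) : ℝ := w j / T (j + 1)

/-- The two recurrences look the same read from the right end, so the reversed profile is
proportional to the profile, with factor w m / w 0. -/
theorem symm (h : PathProfile m K L b w T) :
    (∀ i ≤ m, w (m - i) = w i) ∧ ∀ i ≤ m + 1, T (m + 1 - i) = T i := by
  have key : ∀ i ≤ m, w (m - i) * w 0 = w m * w i ∧ T (m + 1 - i) * w 0 = w m * T i := by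
    intro i
    induction i with
    | zero => intro _; simp [h.T_zero, h.T_last]
    | succ i ih =>
      intro hi
      obtain ⟨h1, h2⟩ := ih (by omega)
      have e1 := h.vertex_eq i (by omega)
      have e2 := h.edge_eq i (by omega)
      have e3 := h.vertex_eq (m - i) (by omega)
      have e4 := h.edge_eq (m - (i + 1)) (by omega)
      rw [show m - i + 1 = m + 1 - i by omega] at e3
      rw [show m - (i + 1) + 1 = m - i by omega] at e4
      rw [show m + 1 - (i + 1) = m - i by omega]
      have hT : T (m - i) * w 0 = w m * T (i + 1) := by
        linear_combination w 0 * e3 - w m * e1 + (L + 1) * h1 - h2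
      refine ⟨?_, hT⟩
      linear_combination w 0 * e4 - w m * e2 + b * hT - h1
  -- At i = m the proportionality reads (w 0)² = (w m)², so the factor is 1.
  have h0 : w m = w 0 := by
    have := (key m le_rfl).1
    simp only [Nat.sub_self] at this
    have p0 := h.w_pos 0 (by omega)
    have pm := h.w_pos m le_rfl
    nlinarith
  have p0 := h.w_pos 0 (by omega)
  constructor
  · intro i hi
    have := (key i hi).1
    rw [h0] at this
    exact mul_right_cancel₀ p0.ne' (by linarith)
  · intro i hi
    rcases hi.eq_or_lt with rfl | hi
    · simp [h.T_zero, h.T_last, h0]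
    have := (key i (by omega)).2
    rw [h0] at this
    exact mul_right_cancel₀ p0.ne' (by linarith)

theorem b_pos (h : PathProfile m K L b w T) (hm : 0 < m) : 0 < b := by
  have e := h.edge_eq 0 hm
  have := h.w_pos 0 (by omega)
  have := h.w_pos 1 hm
  have := h.T_pos 1 (by omega)
  by_contra hb
  nlinarith

theorem w_recurrence (h : PathProfile m K L b w T) {j : ℕ} (hj : j + 2 ≤ m) :
    w j + w (j + 2) = (b * (L + 1) - 2) * w (j + 1) := by
  have e1 := h.edge_eq j (by omega)
  have e2 := h.edge_eq (j + 1) (by omega)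
  have e3 := h.vertex_eq (j + 1) (by omega)
  simp only [add_assoc, Nat.reduceAdd] at *
  linear_combination e1 + e2 + b * e3

/-- Otherwise w is convex by `w_recurrence`, and symmetry gives w 1 ≤ w 0. The first edge equation w
0 + w 1 = (L - K) w 0 then yields L - K ≤ 2, and with b ≤ 1 it follows that b(L + 1) = L - K + b ≤
3. -/
theorem concave (h : PathProfile m K L b w T) (hm : 2 ≤ m) : b * (L + 1) < 4 := by
  by_contra hc
  push Not at hc
  have hsym := h.symm.1
  have hd : ∀ i, i + 1 ≤ m → w 1 - w 0 ≤ w (i + 1) - w i := by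
    intro i
    induction i with
    | zero => intro _; simp
    | succ i ih =>
      intro hi
      have := h.w_recurrence (j := i) (by omega)
      have := ih (by omega)
      have := h.w_pos (i + 1) (by omega)
      simp only [add_assoc, Nat.reduceAdd] at *
      nlinarith
  have h1 := hd (m - 1) (by omega)
  have h2 := hsym 1 (by omega)
  have h3 := hsym 0 (by omega)
  rw [show m - 1 + 1 = m by omega] at h1
  simp only [Nat.sub_zero] at h3
  have e0 := h.edge_eq 0 (by omega)
  have v0 := h.vertex_eq 0 (by omega)
  have hb := h.b_mul
  have p0 := h.w_pos 0 (by omega)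
  have hT1 : T 1 = L * w 0 := by
    have := h.T_zero; simp only [zero_add] at *; linarith
  simp only [zero_add] at e0
  rw [hT1, ← mul_assoc, hb] at e0
  have hLK : L - K ≤ 2 := by
    by_contra hlk
    push Not at hlk
    nlinarith
  have hb1 : b ≤ 1 := by
    have := h.K_nonneg; have := h.L_pos
    by_contra h'
    push Not at h'
    nlinarith
  nlinarith

/-- Increments strictly decrease by concavity, while reflection negates them. An increment left of
the centre exceeds its mirror image, its own negative, and so is positive. -/
theorem w_increasing (h : PathProfile m K L b w T) :
    ∀ i, 2 * i + 1 < m → w i < w (i + 1) := by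
  have hsym := h.symm.1
  intro i hi
  have hc := h.concave (by omega)
  have hd : ∀ d, i + d + 2 ≤ m → w (i + d + 2) - w (i + d + 1) < w (i + 1) - w i := by
    intro d
    induction d with
    | zero =>
      intro hi
      have := h.w_recurrence (j := i) (by omega)
      have := h.w_pos (i + 1) (by omega)
      simp only [add_zero]
      nlinarith
    | succ d ih =>
      intro hi
      have := h.w_recurrence (j := i + d + 1) (by omega)
      have := ih (by omega)
      have := h.w_pos (i + d + 2) (by omega)
      simp only [← add_assoc] at *
      nlinarith
  have h1 := hd (m - 2 * i - 2) (by omega)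
  have h2 := hsym i (by omega)
  have h3 := hsym (i + 1) (by omega)
  rw [show i + (m - 2 * i - 2) + 2 = m - i by omega,
    show i + (m - 2 * i - 2) + 1 = m - (i + 1) by omega] at h1
  linarith

theorem w_unimodal (h : PathProfile m K L b w T) :
    (∀ a b, b ≤ a → a + b ≤ m → w b ≤ w a) ∧ ∀ c, 0 < c → c < m → w 0 < w c :=
  symm_unimodal h.symm.1 h.w_increasing

/-- Consecutive edge equations give b(T (i + 2) - T (i + 1)) = w (i + 2) - w i, so monotonicity
passes from w to T. The shift of index makes the symmetry i ↦ m - 1 - i. -/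
theorem T_unimodal (h : PathProfile m K L b w T) (hm : 0 < m) :
    (∀ a b, b ≤ a → a + b ≤ m - 1 → T (b + 1) ≤ T (a + 1)) ∧
      ∀ c, 0 < c → c < m - 1 → T 1 < T (c + 1) := by
  refine symm_unimodal (z := fun i => T (i + 1)) ?_ ?_
  · intro i hi
    rw [← h.symm.2 (i + 1) (by omega)]
    congr 1
    omega
  · intro i hi
    have hb := h.b_pos hm
    have e1 := h.edge_eq i (by omega)
    have e2 := h.edge_eq (i + 1) (by omega)
    have h1 := h.w_increasing i (by omega)
    have h2 : w (i + 1) ≤ w (i + 2) := h.w_unimodal.1 (i + 2) (i + 1) (by omega) (by omega)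
    simp only [add_assoc, Nat.reduceAdd] at *
    nlinarith

/-- The profile and its shift by c solve the same linear recurrences, so their Casoratian is
constant in a: `vertex_eq` carries it across a vertex and `edge_eq` across an edge. Its value is
read off at a = 0. -/
theorem cross_eq (h : PathProfile m K L b w T) (c : ℕ) :
    ∀ a, a + c ≤ m → T (a + c) * w a - T a * w (a + c) = w 0 * (T c - w c) ∧
      T (a + 1) * w (a + c) - T (a + c + 1) * w a = w 0 * (T c - w c) := by
  intro a
  have step : ∀ a, a + c ≤ m → T (a + 1) * w (a + c) - T (a + c + 1) * w a =
      T (a + c) * w a - T a * w (a + c) := by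
    intro a ha
    linear_combination w (a + c) * h.vertex_eq a (by omega) - w a * h.vertex_eq (a + c) ha
  induction a with
  | zero =>
    intro ha
    have := step 0 ha
    simp only [zero_add] at this ⊢
    rw [this, h.T_zero]
    constructor <;> ring
  | succ a ih =>
    intro ha
    have := (ih (by omega)).2
    rw [step (a + 1) ha, and_self]
    have e1 := h.edge_eq a (by omega)
    have e2 := h.edge_eq (a + c) (by omega)
    rw [show a + 1 + c = a + c + 1 by ring]
    linear_combination this + T (a + c + 1) * e1 - T (a + 1) * e2

theorem excess_pos (h : PathProfile m K L b w T) {j : ℕ} (hj : 0 < j) (hjm : j ≤ m) :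
    0 < T j - w j := by
  obtain ⟨j, rfl⟩ := Nat.exists_eq_succ_of_ne_zero hj.ne'
  have e := h.edge_eq j (by omega)
  have hb : b ≤ 1 := by
    have := h.K_nonneg; have := h.L_pos; have := h.b_mul
    by_contra h'
    push Not at h'
    nlinarith
  have := h.w_pos j (by omega)
  have := h.T_pos (j + 1) (by omega)
  simp only [Nat.succ_eq_add_one] at *
  nlinarith

theorem ratioH_zero (h : PathProfile m K L b w T) : ratioH w T 0 = 0 := by
  simp [ratioH, h.T_zero]

theorem ratioH_last (h : PathProfile m K L b w T) : ratioH w T m = L - 1 := by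
  have := h.w_pos m le_rfl
  have e := h.vertex_eq m le_rfl
  rw [h.T_last] at e
  rw [ratioH, div_eq_iff this.ne']
  linarith

theorem ratioH_add_sub (h : PathProfile m K L b w T) {a c : ℕ} (hac : a + c ≤ m) :
    ratioH w T a + ratioH w T c - ratioH w T (a + c) =
      (T c - w c) * (w a * w (a + c) - w 0 * w c) / (w a * w c * w (a + c)) := by
  have h1 := h.w_pos a (by omega)
  have h2 := h.w_pos c (by omega)
  have h3 := h.w_pos (a + c) (by omega)
  have e := (h.cross_eq c a hac).1
  unfold ratioH
  rw [eq_div_iff (by positivity)]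
  field_simp
  linear_combination (-(w c)) * e

/-- By `ratioH_add_sub` the sign is that of w a · w (a + c) - w 0 · w c. For c ≤ a, unimodality
gives w c ≤ w a and w 0 ≤ w (a + c), the latter strict when a + c is interior. -/
theorem ratioH_add_le_lt (h : PathProfile m K L b w T) {a c : ℕ} (hac : a + c ≤ m) :
    ratioH w T (a + c) ≤ ratioH w T a + ratioH w T c ∧
      (0 < a → 0 < c → a + c < m →
        ratioH w T (a + c) < ratioH w T a + ratioH w T c) := by
  wlog hca : c ≤ a generalizing a c
  · have := this (a := c) (c := a) (by omega) (by omega)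
    rw [add_comm c a] at this
    refine ⟨by linarith [this.1], fun h1 h2 h3 => by linarith [this.2 h2 h1 h3]⟩
  rcases Nat.eq_zero_or_pos c with rfl | hc
  · simp [h.ratioH_zero]
  have h0 := h.w_pos 0 (by omega)
  have h1 := h.w_pos a (by omega)
  have h2 := h.w_pos c (by omega)
  have h3 := h.w_pos (a + c) (by omega)
  have e := h.ratioH_add_sub hac
  have hex := h.excess_pos hc (by omega)
  have hu := h.w_unimodal.1 a c hca hac
  constructor
  · have h4 : w 0 ≤ w (a + c) := h.w_unimodal.1 (a + c) 0 (by omega) (by omega)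
    have : 0 ≤ (T c - w c) * (w a * w (a + c) - w 0 * w c) / (w a * w c * w (a + c)) := by
      refine div_nonneg (mul_nonneg hex.le ?_) (by positivity)
      nlinarith
    linarith
  · intro _ _ hlt
    have h4 := h.w_unimodal.2 (a + c) (by omega) hlt
    have : 0 < (T c - w c) * (w a * w (a + c) - w 0 * w c) / (w a * w c * w (a + c)) := by
      refine div_pos (mul_pos hex ?_) (by positivity)
      nlinarith
    linarith

theorem ratioT_pos (h : PathProfile m K L b w T) {j : ℕ} (hj : j ≤ m) : 0 < ratioT w T j :=
  div_pos (h.w_pos j hj) (h.T_pos (j + 1) (by omega))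

theorem ratioT_mul (h : PathProfile m K L b w T) {j : ℕ} (hj : j ≤ m) :
    ratioT w T j * (L - ratioH w T j) = 1 := by
  have h1 := h.w_pos j hj
  have h2 := h.T_pos (j + 1) (by omega)
  have e := h.vertex_eq j hj
  unfold ratioT ratioH
  field_simp
  linarith

theorem ratioT_zero (h : PathProfile m K L b w T) : ratioT w T 0 = 1 / L := by
  have := h.ratioT_mul (j := 0) (by omega)
  rw [h.ratioH_zero, sub_zero] at this
  have := h.L_pos
  field_simp
  linarith

theorem ratioT_add_sub (h : PathProfile m K L b w T) {a c : ℕ} (hac : a + c ≤ m) :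
    ratioT w T a + ratioT w T c - ratioT w T (a + c) - ratioT w T 0 =
      w 0 * (T c - w c) * (T (a + 1) * T (a + c + 1) - T 1 * T (c + 1)) /
        (T 1 * T (c + 1) * T (a + 1) * T (a + c + 1)) := by
  have h1 := h.T_pos 1 (by omega)
  have h2 := h.T_pos (a + 1) (by omega)
  have h3 := h.T_pos (c + 1) (by omega)
  have h4 := h.T_pos (a + c + 1) (by omega)
  have e := (h.cross_eq c a hac).2
  have e' := (h.cross_eq c 0 (by omega)).2
  simp only [zero_add] at e'
  unfold ratioT
  rw [eq_div_iff (by positivity)]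
  field_simp
  simp only [zero_add]
  linear_combination (-(T 1 * T (c + 1))) * e + T (a + 1) * T (a + c + 1) * e'

/-- The same argument with the edge sums: T (c + 1) ≤ T (a + 1) and T 1 ≤ T (a + c + 1). The term
`ratioT 0` is the share of the leaf that takes the place of a merged branch. -/
theorem ratioT_add_le_lt (h : PathProfile m K L b w T) {a c : ℕ} (hac : a + c + 1 ≤ m) :
    ratioT w T (a + c) + ratioT w T 0 ≤ ratioT w T a + ratioT w T c ∧
      (0 < a → 0 < c → a + c + 1 < m →
        ratioT w T (a + c) + ratioT w T 0 < ratioT w T a + ratioT w T c) := by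
  wlog hca : c ≤ a generalizing a c
  · have := this (a := c) (c := a) (by omega) (by omega)
    rw [add_comm c a] at this
    refine ⟨by linarith [this.1], fun h1 h2 h3 => by linarith [this.2 h2 h1 h3]⟩
  rcases Nat.eq_zero_or_pos c with rfl | hc
  · simp
  have h0 := h.w_pos 0 (by omega)
  have h1 := h.T_pos 1 (by omega)
  have h2 := h.T_pos (a + 1) (by omega)
  have h3 := h.T_pos (c + 1) (by omega)
  have h4 := h.T_pos (a + c + 1) (by omega)
  have e := h.ratioT_add_sub (a := a) (c := c) (by omega)
  have hex := h.excess_pos hc (by omega)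
  have hu := (h.T_unimodal (by omega)).1 a c hca (by omega)
  constructor
  · have h5 : T 1 ≤ T (a + c + 1) := (h.T_unimodal (by omega)).1 (a + c) 0 (by omega) (by omega)
    have : 0 ≤ w 0 * (T c - w c) * (T (a + 1) * T (a + c + 1) - T 1 * T (c + 1)) /
        (T 1 * T (c + 1) * T (a + 1) * T (a + c + 1)) := by
      refine div_nonneg (mul_nonneg (by positivity) ?_) (by positivity)
      nlinarith
    linarith
  · intro _ _ hlt
    have h5 := (h.T_unimodal (by omega)).2 (a + c) (by omega) (by omega)
    have : 0 < w 0 * (T c - w c) * (T (a + 1) * T (a + c + 1) - T 1 * T (c + 1)) /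
        (T 1 * T (c + 1) * T (a + 1) * T (a + c + 1)) := by
      refine div_pos (mul_pos (by positivity) ?_) (by positivity)
      nlinarith
    linarith

/-- In the edge after cut vertex j, K leaves and that cut vertex hold a share s of the edge sum. The
far end holds 1 - s, and its ratio is s / (1 - s); the form without division also avoids assuming s
≠ 1. -/
theorem ratioH_succ (h : PathProfile m K L b w T) {j : ℕ} (hj : j < m) :
    ratioH w T (j + 1) * (1 - (K * ratioT w T 0 + ratioT w T j)) =
      K * ratioT w T 0 + ratioT w T j := by
  have h1 := h.w_pos (j + 1) hj
  have h2 := h.T_pos (j + 1) (by omega)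
  have h3 := h.L_pos
  have e := h.edge_eq j hj
  have hb : b = 1 - K / L := by
    have := h.b_mul
    field_simp
    linarith
  have hs : K * ratioT w T 0 + ratioT w T j = (T (j + 1) - w (j + 1)) / T (j + 1) := by
    rw [h.ratioT_zero, ratioT, eq_div_iff h2.ne', add_mul, div_mul_cancel₀ _ h2.ne']
    rw [hb] at e
    linear_combination e
  rw [hs, ratioH]
  field_simp
  ring

/-- The shares in the last edge add up to 1; it has K + 1 leaves, the end of the path included. -/
theorem ratioT_last (h : PathProfile m K L b w T) (hm : 0 < m) :
    (K + 1) * ratioT w T 0 + ratioT w T (m - 1) = 1 := by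
  obtain ⟨j, rfl⟩ := Nat.exists_eq_succ_of_ne_zero hm.ne'
  have h2 := h.T_pos (j + 1) (by omega)
  have h3 := h.L_pos
  have e := h.edge_eq j (by omega)
  have e' := h.vertex_eq (j + 1) (by omega)
  have hl := h.T_last
  have hb : b = 1 - K / L := by
    have := h.b_mul
    field_simp
    linarith
  simp only [Nat.succ_eq_add_one, Nat.add_sub_cancel] at *
  have hw : w (j + 1) = T (j + 1) / L := by
    field_simp
    linarith
  rw [h.ratioT_zero, ratioT]
  rw [hb, hw] at e
  have : w j = (1 - K / L) * T (j + 1) - T (j + 1) / L := by linarith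
  rw [this]
  field_simp
  ring

end PathProfile

/-! ### Hypertrees and induction over connected parts -/

open Relation

/-- Two vertices are linked by `F` when some edge of `F` contains both. -/
def EdgeLink {α : Type*} (F : Finset (Finset α)) (a b : α) : Prop := ∃ f ∈ F, a ∈ f ∧ b ∈ f

theorem EdgeLink.mono {α : Type*} {F F' : Finset (Finset α)} (h : F ⊆ F') {a b : α}
    (hab : ReflTransGen (EdgeLink F) a b) : ReflTransGen (EdgeLink F') a b :=
  ReflTransGen.mono (fun _ _ ⟨f, hf, h'⟩ => ⟨f, h hf, h'⟩) _ _ hab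

theorem EdgeLink.symm {α : Type*} {F : Finset (Finset α)} {a b : α}
    (hab : ReflTransGen (EdgeLink F) a b) : ReflTransGen (EdgeLink F) b a := by
  induction hab with
  | refl => rfl
  | tail _ hbc ih =>
    obtain ⟨f, hf, h1, h2⟩ := hbc
    exact ReflTransGen.head ⟨f, hf, h2, h1⟩ ih

/-- A connected `k`-uniform hypergraph in which no two vertices of an edge remain connected after
deleting that edge. -/
structure IsHypertree {α : Type*} [DecidableEq α] (k : ℕ) (V : Finset α)
    (E : Finset (Finset α)) : Prop where
  card_edge : ∀ e ∈ E, e.card = k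
  subset : ∀ e ∈ E, e ⊆ V
  nonempty : V.Nonempty
  bridge : ∀ e ∈ E, ∀ x ∈ e, ∀ y ∈ e, ReflTransGen (EdgeLink (E.erase e)) x y → x = y
  connected : ∀ x ∈ V, ∀ y ∈ V, ReflTransGen (EdgeLink E) x y

/-- A nonempty connected part of a hypergraph with edge set `E` and vertex set `V`. -/
structure IsConnectedPart {α : Type*} (V : Finset α) (E : Finset (Finset α))
    (W : Finset α) (F : Finset (Finset α)) : Prop where
  subset_E : F ⊆ E
  subset_V : W ⊆ V
  subset_W : ∀ f ∈ F, f ⊆ W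
  nonempty : W.Nonempty
  connected : ∀ x ∈ W, ∀ y ∈ W, ReflTransGen (EdgeLink F) x y

theorem exists_step_leaving {α : Type*} {r : α → α → Prop} {W : Finset α} {x y : α}
    (h : ReflTransGen r x y) (hx : x ∈ W) (hy : y ∉ W) :
    ∃ a b, a ∈ W ∧ b ∉ W ∧ r a b := by
  induction h with
  | refl => exact absurd hx hy
  | tail _ hbc ih =>
    rename_i b c _
    by_cases hb : b ∈ W
    · exact ⟨b, c, hb, hy, hbc⟩
    · exact ih hb

namespace IsHypertree

variable {α : Type*} [DecidableEq α] {k : ℕ} {V : Finset α} {E : Finset (Finset α)}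

theorem eq_of_mem_inter (h : IsHypertree k V E) {e f : Finset α} (he : e ∈ E) (hf : f ∈ E)
    (hef : e ≠ f) {x y : α} (hx : x ∈ e) (hy : y ∈ e) (hx' : x ∈ f) (hy' : y ∈ f) : x = y :=
  h.bridge e he x hx y hy
    (ReflTransGen.single ⟨f, Finset.mem_erase.2 ⟨hef.symm, hf⟩, hx', hy'⟩)

theorem eq_of_mem_part (h : IsHypertree k V E) {W : Finset α} {F : Finset (Finset α)}
    (hp : IsConnectedPart V E W F) {e : Finset α} (he : e ∈ E) (heF : e ∉ F) {x y : α}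
    (hx : x ∈ e) (hy : y ∈ e) (hx' : x ∈ W) (hy' : y ∈ W) : x = y :=
  h.bridge e he x hx y hy <| EdgeLink.mono
    (fun _ hf => Finset.mem_erase.2 ⟨ne_of_mem_of_not_mem hf heF, hp.subset_E hf⟩)
    (hp.connected x hx' y hy')

/-- Downward induction along the connected parts of a hypertree. -/
theorem part_induction (h : IsHypertree k V E) (hk : 2 ≤ k)
    {motive : Finset α → Finset (Finset α) → Prop} (full : motive V E)
    (step : ∀ W F e v, IsConnectedPart V E W F → e ∈ E → e ∉ F → v ∈ e → v ∈ W →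
      Disjoint W (e.erase v) → motive (W ∪ e.erase v) (insert e F) → motive W F) :
    ∀ W F, IsConnectedPart V E W F → motive W F := by
  intro W F hp
  obtain ⟨N, hN⟩ : ∃ N, (E \ F).card = N := ⟨_, rfl⟩
  induction N generalizing W F with
  | zero =>
    have hFE : F = E := hp.subset_E.antisymm
      (Finset.sdiff_eq_empty_iff_subset.1 (Finset.card_eq_zero.1 hN))
    subst hFE
    have : W = V := by
      refine hp.subset_V.antisymm fun y hy => ?_
      by_contra hyW
      obtain ⟨x, hx⟩ := hp.nonempty
      obtain ⟨a, b, _, hb, f, hf, _, hbf⟩ :=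
        exists_step_leaving (h.connected x (hp.subset_V hx) y hy) hx hyW
      exact hb (hp.subset_W f hf hbf)
    exact this ▸ full
  | succ N ih =>
    have hstep : ∃ e v, e ∈ E ∧ e ∉ F ∧ v ∈ e ∧ v ∈ W := by
      by_cases hWV : W = V
      · obtain ⟨e, he⟩ := Finset.card_pos.1 (show 0 < (E \ F).card by omega)
        obtain ⟨he, heF⟩ := Finset.mem_sdiff.1 he
        obtain ⟨v, hv⟩ := Finset.card_pos.1 (show 0 < e.card by rw [h.card_edge e he]; omega)
        exact ⟨e, v, he, heF, hv, hWV ▸ h.subset e he hv⟩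
      · obtain ⟨y, hy, hyW⟩ := Finset.exists_of_ssubset (hp.subset_V.ssubset_of_ne hWV)
        obtain ⟨x, hx⟩ := hp.nonempty
        obtain ⟨a, b, ha, hb, f, hf, haf, hbf⟩ :=
          exists_step_leaving (h.connected x (hp.subset_V hx) y hy) hx hyW
        exact ⟨f, a, hf, fun hfF => hb (hp.subset_W f hfF hbf), haf, ha⟩
    obtain ⟨e, v, he, heF, hve, hvW⟩ := hstep
    -- A second common vertex of e and W would be joined to v inside the part, against the bridge
    -- property of e.
    refine step W F e v hp he heF hve hvW ?_ (ih _ _ ?_ ?_)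
    · refine Finset.disjoint_left.2 fun x hxW hxe => ?_
      obtain ⟨hxv, hxe⟩ := Finset.mem_erase.1 hxe
      exact hxv (h.eq_of_mem_part hp he heF hxe hve hxW hvW)
    · refine ⟨Finset.insert_subset he hp.subset_E, Finset.union_subset hp.subset_V
        ((Finset.erase_subset _ _).trans (h.subset e he)), ?_, hp.nonempty.mono
        Finset.subset_union_left, ?_⟩
      · intro f hf
        rcases Finset.mem_insert.1 hf with rfl | hf
        · intro x hx
          by_cases hxv : x = v
          · exact Finset.mem_union_left _ (hxv ▸ hvW)
          · exact Finset.mem_union_right _ (Finset.mem_erase.2 ⟨hxv, hx⟩)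
        · exact (hp.subset_W f hf).trans Finset.subset_union_left
      · have key : ∀ x ∈ W ∪ e.erase v, ReflTransGen (EdgeLink (insert e F)) x v := by
          intro x hx
          rcases Finset.mem_union.1 hx with hx | hx
          · exact EdgeLink.mono (Finset.subset_insert _ _) (hp.connected x hx v hvW)
          · exact ReflTransGen.single ⟨e, Finset.mem_insert_self _ _,
              Finset.mem_of_mem_erase hx, hve⟩
        exact fun x hx y hy => (key x hx).trans (EdgeLink.symm (key y hy))
    · have : E \ F = insert e (E \ insert e F) := by
        ext f; simp only [Finset.mem_sdiff, Finset.mem_insert]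
        constructor
        · tauto
        · rintro (rfl | h) <;> tauto
      rw [this, Finset.card_insert_of_notMem (by simp)] at hN
      omega

/-- The difference |W| - |F|(k - 1) is the same for all connected parts, since attaching an edge
adds k - 1 vertices. The whole hypertree is compared with a single vertex. -/
theorem card_vertices (h : IsHypertree k V E) (hk : 2 ≤ k) :
    V.card = E.card * (k - 1) + 1 := by
  obtain ⟨r, hr⟩ := h.nonempty
  have := h.part_induction hk
    (motive := fun W F => V.card + F.card * (k - 1) = W.card + E.card * (k - 1)) (by simp) ?_
    {r} ∅ ⟨by simp, by simpa using hr, by simp, by simp, ?_⟩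
  · simp only [Finset.card_empty, Finset.card_singleton] at this
    omega
  · intro W F e v _ he heF hve _ hdis hm
    rw [Finset.card_insert_of_notMem heF, Finset.card_union_of_disjoint hdis,
      Finset.card_erase_of_mem hve, h.card_edge e he, add_mul] at hm
    omega
  · intro x hx y hy
    simp only [Finset.mem_singleton] at hx hy
    rw [hx, hy]

end IsHypertree

/-! ### Replacing branches by path branches -/

namespace PathProfile

variable {m : ℕ} {K L b : ℝ} {w T : ℕ → ℝ} {α : Type*}

theorem le_sum_ratioT (h : PathProfile m K L b w T) (c : α → ℕ) {s : Finset α}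
    (hs : s.Nonempty) (hc : ∑ u ∈ s, c u < m) :
    ((s.card : ℝ) - 1) * ratioT w T 0 + ratioT w T (∑ u ∈ s, c u) ≤
      ∑ u ∈ s, ratioT w T (c u) := by
  induction hs using Finset.Nonempty.cons_induction with
  | singleton a => simp
  | cons a s ha hs ih =>
    rw [Finset.sum_cons] at hc
    have := ih (by omega)
    have h2 := (h.ratioT_add_le_lt (a := c a) (c := ∑ u ∈ s, c u) (by omega)).1
    rw [Finset.sum_cons, Finset.sum_cons, Finset.card_cons]
    push_cast
    linarith

theorem ratioT_mul_le (h : PathProfile m K L b w T) {Y yu : ℝ} {j : ℕ} (hj : j ≤ m)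
    (hu : Y - yu + ratioH w T j * yu ≤ (L - 1) * yu) : ratioT w T j * Y ≤ yu := by
  have h1 := h.ratioT_pos hj
  have h2 := h.ratioT_mul hj
  have : Y ≤ (L - ratioH w T j) * yu := by linarith
  calc ratioT w T j * Y ≤ ratioT w T j * ((L - ratioH w T j) * yu) := by gcongr
    _ = yu := by rw [← mul_assoc, h2, one_mul]

variable [DecidableEq α]

/-- Each vertex u ≠ v of e holds at least the share `ratioT (c u)` of the edge sum Y. By
subadditivity these shares total at least s, the share occurring in `ratioH_succ` for a path branch
with Σ c edges, so v keeps at most (1 - s)Y and the ratio at v is at least s / (1 - s). -/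
theorem edge_bound (h : PathProfile m K L b w T) {e : Finset α} (he : (e.card : ℝ) = K + 2)
    {v : α} (hv : v ∈ e) (y : α → ℝ) (hy : ∀ u ∈ e, 0 < y u) (c : α → ℕ)
    (hc : ∑ u ∈ e.erase v, c u < m)
    (hu : ∀ u ∈ e.erase v,
      ∑ z ∈ e, y z - y u + ratioH w T (c u) * y u ≤ (L - 1) * y u) :
    ratioH w T (1 + ∑ u ∈ e.erase v, c u) * y v ≤ ∑ z ∈ e, y z - y v := by
  set Y := ∑ z ∈ e, y z with hY
  have hcard : ((e.erase v).card : ℝ) = K + 1 := by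
    have := Finset.card_erase_add_one hv
    have : ((e.erase v).card : ℝ) + 1 = e.card := by exact_mod_cast this
    linarith
  have hne : (e.erase v).Nonempty := by
    rw [← Finset.card_pos]
    have := h.K_nonneg
    have : (0 : ℝ) < (e.erase v).card := by linarith
    exact_mod_cast this
  have hsum := h.le_sum_ratioT c hne hc
  have hYpos : 0 < Y := Finset.sum_pos hy ⟨v, hv⟩
  have hD : Y - y v = ∑ u ∈ e.erase v, y u := by
    rw [hY, ← Finset.add_sum_erase e y hv]; ring
  have hle : (∑ u ∈ e.erase v, ratioT w T (c u)) * Y ≤ Y - y v := by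
    rw [hD, Finset.sum_mul]
    refine Finset.sum_le_sum fun u hu' => h.ratioT_mul_le ?_ (hu u hu')
    exact (Finset.single_le_sum (f := c) (fun _ _ => Nat.zero_le _) hu').trans hc.le
  have hrec := h.ratioH_succ hc
  rw [add_comm 1]
  set s := K * ratioT w T 0 + ratioT w T (∑ u ∈ e.erase v, c u)
  have hs : s * Y ≤ Y - y v := by
    refine le_trans ?_ hle
    gcongr
    rw [hcard] at hsum
    linarith
  have hyv := hy v hv
  -- If s ≥ 1, then Y ≤ sY ≤ Y - y v < Y.
  have hs1 : 0 < 1 - s := by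
    by_contra hneg
    push Not at hneg
    nlinarith
  have : (1 - s) * (ratioH w T (∑ u ∈ e.erase v, c u + 1) * y v) ≤ (1 - s) * (Y - y v) := by
    have e1 : (1 - s) * (ratioH w T (∑ u ∈ e.erase v, c u + 1) * y v) = s * y v := by
      linear_combination y v * hrec
    rw [e1]
    linarith
  exact le_of_mul_le_mul_left this hs1

variable {k : ℕ} {V : Finset α} {E : Finset (Finset α)} {y : α → ℝ}

/-- A connected part together with the number of edges of the branches cut off at its vertices. -/
theorem exists_weights (h : PathProfile m K L b w T) (hT : IsHypertree k V E) (hk : 2 ≤ k)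
    (hK : (k : ℝ) = K + 2) (hm : E.card = m) (hy : ∀ u ∈ V, 0 < y u)
    (hle : ∀ u ∈ V, ∑ e ∈ E with u ∈ e, (∑ z ∈ e, y z - y u) ≤ (L - 1) * y u) :
    ∀ W F, IsConnectedPart V E W F → ∃ c : α → ℕ, ∑ u ∈ W, c u + F.card = m ∧
      (∀ u ∈ W, ∑ e ∈ F with u ∈ e, (∑ z ∈ e, y z - y u) + ratioH w T (c u) * y u ≤
        (L - 1) * y u) ∧
      ∀ u ∈ W, ∀ f ∈ E, f ∉ F → u ∈ f → 0 < c u := by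
  refine hT.part_induction hk ?_ ?_
  -- Nothing is cut off yet, and `ratioH 0 = 0`.
  · exact ⟨fun _ => 0, by simpa using hm,
      by simpa [h.ratioH_zero] using hle, fun u _ f hf hf' => absurd hf hf'⟩
  · rintro W F e v hp he heF hve hvW hdis ⟨c, hc1, hc2, hc3⟩
    rw [Finset.sum_union hdis, Finset.card_insert_of_notMem heF] at hc1
    have hWv := Finset.add_sum_erase W c hvW
    have hedge : ratioH w T (1 + ∑ u ∈ e.erase v, c u) * y v ≤ ∑ z ∈ e, y z - y v := by
      refine h.edge_bound (by rw [hT.card_edge e he, hK]) hve y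
        (fun u hu => hy u (hT.subset e he hu)) c (by omega) fun u hu => ?_
      have := hc2 u (Finset.mem_union_right _ hu)
      have hfil : (insert e F).filter (u ∈ ·) = {e} := by
        ext f
        simp only [Finset.mem_filter, Finset.mem_insert, Finset.mem_singleton]
        constructor
        · rintro ⟨rfl | hf, huf⟩
          · rfl
          · exact absurd hu (Finset.disjoint_left.1 hdis (hp.subset_W f hf huf))
        · rintro rfl
          exact ⟨Or.inl rfl, Finset.mem_of_mem_erase hu⟩
      rwa [hfil, Finset.sum_singleton] at this
    -- Pruning e moves e itself and all branches at its other vertices into the branch count of v.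
    refine ⟨Function.update c v (c v + (1 + ∑ u ∈ e.erase v, c u)), ?_, ?_, ?_⟩
    · have hupd : ∑ u ∈ W.erase v, Function.update c v (c v + (1 + ∑ u ∈ e.erase v, c u)) u =
          ∑ u ∈ W.erase v, c u :=
        Finset.sum_congr rfl fun u hu => Function.update_of_ne (Finset.ne_of_mem_erase hu) ..
      rw [← Finset.add_sum_erase W _ hvW, Function.update_self, hupd]
      omega
    · intro u hu
      have := hc2 u (Finset.mem_union_left _ hu)
      rw [Finset.filter_insert] at this
      by_cases huv : u = v
      · subst huv
        rw [if_pos hve, Finset.sum_insert (by simp [heF])] at this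
        rw [Function.update_self]
        have hadd := (h.ratioH_add_le_lt (a := c u) (c := 1 + ∑ z ∈ e.erase u, c z)
          (by omega)).1
        have := mul_le_mul_of_nonneg_right hadd (hy u (hp.subset_V hu)).le
        linarith
      · have hue : u ∉ e := fun hue =>
          Finset.disjoint_left.1 hdis hu (Finset.mem_erase.2 ⟨huv, hue⟩)
        rw [if_neg hue] at this
        rwa [Function.update_of_ne huv]
    · intro u hu f hf hfF huf
      by_cases huv : u = v
      · subst huv
        simp only [Function.update_self]
        omega
      · rw [Function.update_of_ne huv]
        refine hc3 u (Finset.mem_union_left _ hu) f hf ?_ huf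
        rw [Finset.mem_insert]
        rintro (rfl | hf')
        · exact Finset.disjoint_left.1 hdis hu (Finset.mem_erase.2 ⟨huv, huf⟩)
        · exact hfF hf'

/-- No edge has three vertices that lie in further edges. -/
theorem not_branching_edge (h : PathProfile m K L b w T) (hT : IsHypertree k V E) (hk : 2 ≤ k)
    (hK : (k : ℝ) = K + 2) (hm : E.card = m) (hy : ∀ u ∈ V, 0 < y u)
    (hle : ∀ u ∈ V, ∑ e ∈ E with u ∈ e, (∑ z ∈ e, y z - y u) ≤ (L - 1) * y u)
    {e : Finset α} (he : e ∈ E) {u₁ u₂ u₃ : α} (h₁ : u₁ ∈ e) (h₂ : u₂ ∈ e) (h₃ : u₃ ∈ e)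
    (h₁₂ : u₁ ≠ u₂) (h₁₃ : u₁ ≠ u₃) (h₂₃ : u₂ ≠ u₃)
    (hd : ∀ u, u = u₁ ∨ u = u₂ ∨ u = u₃ → ∃ f ∈ E, f ≠ e ∧ u ∈ f) : False := by
  obtain ⟨c, hc1, hc2, hc3⟩ := h.exists_weights hT hk hK hm hy hle e {e}
    ⟨by simpa using he, hT.subset e he, by simp, ⟨u₁, h₁⟩, fun x hx y hy =>
      ReflTransGen.single ⟨e, by simp, hx, hy⟩⟩
  have hpos : ∀ u ∈ e, (u = u₁ ∨ u = u₂ ∨ u = u₃) → 0 < c u := by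
    intro u hu hu'
    obtain ⟨f, hf, hfe, huf⟩ := hd u hu'
    exact hc3 u hu f hf (by simpa using hfe) huf
  have p1 := hpos u₁ h₁ (by simp)
  have p2 := hpos u₂ h₂ (by simp)
  have p3 := hpos u₃ h₃ (by simp)
  rw [Finset.card_singleton] at hc1
  -- The vertices of e hold at least the shares `ratioT (c u)` of the sum over e, so these shares
  -- total at most 1.
  have hle1 : (∑ u ∈ e, ratioT w T (c u)) * ∑ z ∈ e, y z ≤ ∑ z ∈ e, y z := by
    rw [Finset.sum_mul]
    refine Finset.sum_le_sum fun u hu => h.ratioT_mul_le ?_ ?_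
    · have := Finset.single_le_sum (f := c) (fun _ _ => Nat.zero_le _) hu
      omega
    · have := hc2 u hu
      rwa [Finset.filter_singleton, if_pos hu, Finset.sum_singleton] at this
  have hYpos : 0 < ∑ z ∈ e, y z :=
    Finset.sum_pos (fun u hu => hy u (hT.subset e he hu)) ⟨u₁, h₁⟩
  have hle2 : ∑ u ∈ e, ratioT w T (c u) ≤ 1 := by
    by_contra hgt
    push Not at hgt
    nlinarith
  have m2 : u₂ ∈ e.erase u₁ := Finset.mem_erase.2 ⟨h₁₂.symm, h₂⟩
  have m3 : u₃ ∈ (e.erase u₁).erase u₂ :=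
    Finset.mem_erase.2 ⟨h₂₃.symm, Finset.mem_erase.2 ⟨h₁₃.symm, h₃⟩⟩
  have s1 := Finset.add_sum_erase e c h₁
  have s2 := Finset.add_sum_erase _ c m2
  have t1 := Finset.add_sum_erase e (fun u => ratioT w T (c u)) h₁
  have t2 := Finset.add_sum_erase _ (fun u => ratioT w T (c u)) m2
  have s3 := Finset.single_le_sum (f := c) (fun _ _ => Nat.zero_le _) m3
  have n1 := Finset.card_erase_add_one h₁
  have n2 := Finset.card_erase_add_one m2
  rw [hT.card_edge e he] at n1
  have hcard : ((((e.erase u₁).erase u₂).card : ℕ) : ℝ) = K := by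
    have : ((((e.erase u₁).erase u₂).card + 2 : ℕ) : ℝ) = (k : ℝ) := by
      congr 1; omega
    push_cast at this
    linarith
  have hrest := h.le_sum_ratioT c (s := (e.erase u₁).erase u₂) ⟨u₃, m3⟩ (by omega)
  -- Strict because the third branch is nonempty: c u₁ + c u₂ + 1 < m.
  have q1 := (h.ratioT_add_le_lt (a := c u₁) (c := c u₂) (by omega)).2 p1 p2 (by omega)
  have q2 := (h.ratioT_add_le_lt (a := c u₁ + c u₂)
    (c := ∑ u ∈ (e.erase u₁).erase u₂, c u) (by omega)).1
  rw [show c u₁ + c u₂ + ∑ u ∈ (e.erase u₁).erase u₂, c u = m - 1 by omega] at q2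
  have q3 := h.ratioT_last (by omega)
  rw [hcard] at hrest
  linarith

/-- No vertex lies in three edges. -/
theorem not_branching_vertex (h : PathProfile m K L b w T) (hT : IsHypertree k V E) (hk : 2 ≤ k)
    (hK : (k : ℝ) = K + 2) (hm : E.card = m) (hy : ∀ u ∈ V, 0 < y u)
    (hle : ∀ u ∈ V, ∑ e ∈ E with u ∈ e, (∑ z ∈ e, y z - y u) ≤ (L - 1) * y u)
    {v : α} {e₁ e₂ e₃ : Finset α} (he₁ : e₁ ∈ E) (he₂ : e₂ ∈ E) (he₃ : e₃ ∈ E)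
    (h₁ : v ∈ e₁) (h₂ : v ∈ e₂) (h₃ : v ∈ e₃)
    (h₁₂ : e₁ ≠ e₂) (h₁₃ : e₁ ≠ e₃) (h₂₃ : e₂ ≠ e₃) : False := by
  have hF : ∀ f ∈ ({e₁, e₂, e₃} : Finset (Finset α)), f ∈ E ∧ v ∈ f := by
    intro f hf
    simp only [Finset.mem_insert, Finset.mem_singleton] at hf
    rcases hf with rfl | rfl | rfl <;> exact ⟨by assumption, by assumption⟩
  have hconn : ∀ x ∈ e₁ ∪ e₂ ∪ e₃,
      ReflTransGen (EdgeLink ({e₁, e₂, e₃} : Finset (Finset α))) x v := by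
    intro x hx
    simp only [Finset.mem_union] at hx
    rcases hx with (hx | hx) | hx
    · exact ReflTransGen.single ⟨e₁, by simp, hx, h₁⟩
    · exact ReflTransGen.single ⟨e₂, by simp, hx, h₂⟩
    · exact ReflTransGen.single ⟨e₃, by simp, hx, h₃⟩
  obtain ⟨c, hc1, hc2, -⟩ := h.exists_weights hT hk hK hm hy hle (e₁ ∪ e₂ ∪ e₃) {e₁, e₂, e₃}
    ⟨fun f hf => (hF f hf).1, Finset.union_subset (Finset.union_subset (hT.subset _ he₁)
      (hT.subset _ he₂)) (hT.subset _ he₃), by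
        intro f hf x hx
        simp only [Finset.mem_insert, Finset.mem_singleton] at hf
        simp only [Finset.mem_union]
        rcases hf with rfl | rfl | rfl <;> simp [hx],
      ⟨v, by simp [h₁]⟩, fun x hx y hy => (hconn x hx).trans (EdgeLink.symm (hconn y hy))⟩
  have hdisj : ∀ e ∈ ({e₁, e₂, e₃} : Finset (Finset α)),
      ∀ f ∈ ({e₁, e₂, e₃} : Finset (Finset α)), e ≠ f →
      Disjoint (e.erase v) (f.erase v) := by
    intro e he f hf hef
    refine Finset.disjoint_left.2 fun x hxe hxf => ?_
    rw [Finset.mem_erase] at hxe hxf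
    exact hxe.1 (hT.eq_of_mem_inter (hF e he).1 (hF f hf).1 hef hxe.2 (hF e he).2 hxf.2
      (hF f hf).2)
  have hW : e₁ ∪ e₂ ∪ e₃ = insert v (e₁.erase v ∪ e₂.erase v ∪ e₃.erase v) := by
    ext x
    by_cases hx : x = v
    · simp [hx, h₁]
    · simp [hx]
  have hcard : ({e₁, e₂, e₃} : Finset (Finset α)).card = 3 := by
    rw [Finset.card_eq_three]
    exact ⟨e₁, e₂, e₃, h₁₂, h₁₃, h₂₃, rfl⟩
  have hsum : ∑ u ∈ e₁ ∪ e₂ ∪ e₃, c u = c v + (∑ u ∈ e₁.erase v, c u + ∑ u ∈ e₂.erase v, c u +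
      ∑ u ∈ e₃.erase v, c u) := by
    rw [hW, Finset.sum_insert (by simp), Finset.sum_union, Finset.sum_union]
    · exact hdisj _ (by simp) _ (by simp) h₁₂
    · exact Finset.disjoint_union_left.2 ⟨hdisj _ (by simp) _ (by simp) h₁₃,
        hdisj _ (by simp) _ (by simp) h₂₃⟩
  rw [hcard, hsum] at hc1
  have hedge : ∀ e ∈ ({e₁, e₂, e₃} : Finset (Finset α)), ∑ u ∈ e.erase v, c u < m →
      ratioH w T (1 + ∑ u ∈ e.erase v, c u) * y v ≤ ∑ z ∈ e, y z - y v := by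
    intro e he hlt
    refine h.edge_bound (by rw [hT.card_edge e (hF e he).1, hK]) (hF e he).2 y
      (fun u hu => hy u (hT.subset e (hF e he).1 hu)) c hlt fun u hu => ?_
    have hu' := Finset.mem_of_mem_erase hu
    have := hc2 u (by
      have he' := he
      simp only [Finset.mem_insert, Finset.mem_singleton] at he'
      simp only [Finset.mem_union]
      rcases he' with rfl | rfl | rfl <;> simp [hu'])
    have hfil : ({e₁, e₂, e₃} : Finset (Finset α)).filter (u ∈ ·) = {e} := by
      ext f
      rw [Finset.mem_filter, Finset.mem_singleton]
      constructor
      · rintro ⟨hf, huf⟩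
        by_contra hfe
        exact Finset.disjoint_left.1 (hdisj f hf e he hfe)
          (Finset.mem_erase.2 ⟨Finset.ne_of_mem_erase hu, huf⟩) hu
      · rintro rfl
        exact ⟨he, hu'⟩
    rwa [hfil, Finset.sum_singleton] at this
  have g1 := hedge e₁ (by simp) (by omega)
  have g2 := hedge e₂ (by simp) (by omega)
  have g3 := hedge e₃ (by simp) (by omega)
  have hv := hc2 v (by simp [h₁])
  rw [Finset.filter_true_of_mem (fun f hf => (hF f hf).2),
    Finset.sum_insert (by simp [h₁₂, h₁₃]), Finset.sum_insert (by simp [h₂₃]),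
    Finset.sum_singleton] at hv
  have hyv := hy v (hT.subset _ he₁ h₁)
  set j₁ := 1 + ∑ u ∈ e₁.erase v, c u
  set j₂ := 1 + ∑ u ∈ e₂.erase v, c u
  set j₃ := 1 + ∑ u ∈ e₃.erase v, c u
  -- Strict because j₃ ≥ 1 leaves j₁ + j₂ < m. The merged branches have m edges in total, and
  -- `ratioH m = L - 1` is the entire neighbour sum allowed at v.
  have r1 := (h.ratioH_add_le_lt (a := j₁) (c := j₂) (by omega)).2 (by omega) (by omega) (by omega)
  have r2 := (h.ratioH_add_le_lt (a := j₁ + j₂) (c := j₃) (by omega)).1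
  have r3 := (h.ratioH_add_le_lt (a := j₁ + j₂ + j₃) (c := c v) (by omega)).1
  rw [show j₁ + j₂ + j₃ + c v = m by omega, h.ratioH_last] at r3
  have : (L - 1) * y v < (ratioH w T j₁ + ratioH w T j₂ + ratioH w T j₃ + ratioH w T (c v)) * y v :=
    mul_lt_mul_of_pos_right (by linarith) hyv
  linarith

end PathProfile

/-! ### Supertrees are hypertrees -/

namespace Hypergraph

variable {α : Type*} {H : Hypergraph α}

theorem IsAcyclic.eq_of_mem_inter (hH : H.IsAcyclic) {e f : Set α} (he : e ∈ H.edgeSet)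
    (hf : f ∈ H.edgeSet) (hef : e ≠ f) {x y : α} (hx : x ∈ e) (hy : y ∈ e) (hx' : x ∈ f)
    (hy' : y ∈ f) : x = y := by
  by_contra hxy
  refine hH 1 (fun i => if i = 0 then x else y) (fun i => if i = 0 then e else f)
    ⟨le_rfl, ⟨?_, ?_, ?_, ?_, ?_, ?_, ?_, ?_⟩, ?_, ?_, ?_, ?_, ?_, ?_, ?_⟩
  · intro i _
    split_ifs
    · exact H.subset_vertexSet_of_mem_edgeSet' he hx
    · exact H.subset_vertexSet_of_mem_edgeSet' he hy
  · intro i hi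
    simpa [show i = 0 by omega] using he
  · intro i hi j hj hij
    simp only [Set.mem_Iic] at hi hj
    have : i = 0 ∨ i = 1 := by omega
    have : j = 0 ∨ j = 1 := by omega
    grind
  · intro i hi j hj _
    simp only [Set.mem_Iio] at hi hj
    omega
  · intro i hi
    simpa [show i = 0 by omega] using hx
  · intro i hi
    simpa [show i = 0 by omega] using hy
  · intro i hi
    omega
  · intro i j hi hj
    omega
  · simpa using hf
  · intro i hi
    simpa [show i = 0 by omega] using hef.symm
  · simpa using hx'
  · simpa using hy'
  · intro h; omega
  · intro h; omega
  · intro j h1 h2; omega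

/-- A walk of length `q` through edges other than `e`. -/
structure IsWalkAvoiding (H : Hypergraph α) (e : Set α) (q : ℕ) (v : ℕ → α) (f : ℕ → Set α) :
    Prop where
  edge_mem : ∀ i < q, f i ∈ H.edgeSet
  edge_ne : ∀ i < q, f i ≠ e
  left_mem : ∀ i < q, v i ∈ f i
  right_mem : ∀ i < q, v (i + 1) ∈ f i

/-- Strong induction on length. Any repetition or unwanted intersection shortens the walk while
keeping distinct ends in e, against the induction hypothesis; a walk without shortcuts closes up
with e to a hypercycle. -/
theorem IsAcyclic.eq_of_walk (hH : H.IsAcyclic) {e : Set α} (he : e ∈ H.edgeSet) :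
    ∀ q v f, H.IsWalkAvoiding e q v f → v 0 ∈ e → v q ∈ e → v 0 = v q := by
  intro q
  induction q using Nat.strong_induction_on with
  | _ q ih =>
  intro v f hw h0 hq
  by_contra hne
  have hq0 : 0 < q := by
    rcases Nat.eq_zero_or_pos q with rfl | h
    · exact absurd rfl hne
    · exact h
  have skip : ∀ i j, i < j → j < q → v i ∉ f j := by
    intro i j hij hj hmem
    have := ih (q - (j - i)) (by omega) (fun t => if t ≤ i then v t else v (t + (j - i)))
      (fun t => if t < i then f t else f (t + (j - i))) ⟨?_, ?_, ?_, ?_⟩ (by simpa using h0) ?_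
    · rw [if_pos (by omega), if_neg (by omega), show q - (j - i) + (j - i) = q by omega] at this
      exact hne this
    · intro t ht
      split_ifs
      · exact hw.edge_mem t (by omega)
      · exact hw.edge_mem _ (by omega)
    · intro t ht
      split_ifs
      · exact hw.edge_ne t (by omega)
      · exact hw.edge_ne _ (by omega)
    · intro t ht
      rcases lt_trichotomy t i with h | rfl | h
      · simpa [h, h.le] using hw.left_mem t (by omega)
      · simpa [Nat.add_sub_cancel' hij.le] using hmem
      · simpa [show ¬ t ≤ i by omega, show ¬ t < i by omega] using hw.left_mem _ (by omega)
    · intro t ht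
      by_cases h : t < i
      · simpa [h, show t + 1 ≤ i by omega] using hw.right_mem t (by omega)
      · have := hw.right_mem (t + (j - i)) (by omega)
        rw [if_neg (by omega), if_neg (by omega), show t + 1 + (j - i) = t + (j - i) + 1 by omega]
        exact this
    · rw [if_neg (by omega), show q - (j - i) + (j - i) = q by omega]
      exact hq
  have hvinj : ∀ i j, i < j → j ≤ q → v i ≠ v j := by
    intro i j hij hj heq
    rcases hj.eq_or_lt with rfl | hj
    · rcases Nat.eq_zero_or_pos i with rfl | hi
      · exact hne heq
      · refine hne ((ih i hij v f ⟨fun t ht => hw.edge_mem t (by omega),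
          fun t ht => hw.edge_ne t (by omega), fun t ht => hw.left_mem t (by omega),
          fun t ht => hw.right_mem t (by omega)⟩ h0 (heq ▸ hq)).trans heq)
    · exact skip i j hij hj (heq ▸ hw.left_mem j hj)
  have heinj : ∀ i j, i < j → j < q → f i ≠ f j := fun i j hij hj heq =>
    skip i j hij hj (heq ▸ hw.left_mem i (by omega))
  -- A common vertex z of two non-consecutive edges replaces the piece of the walk between them.
  have hdisj : ∀ i j, i + 2 ≤ j → j < q → Disjoint (f i) (f j) := by
    intro i j hij hj
    refine Set.disjoint_left.2 fun z hzi hzj => ?_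
    have := ih (q - (j - i) + 1) (by omega)
      (fun t => if t ≤ i then v t else if t = i + 1 then z else v (t + (j - i - 1)))
      (fun t => if t ≤ i then f t else f (t + (j - i - 1))) ⟨?_, ?_, ?_, ?_⟩ (by simpa using h0) ?_
    · rw [if_pos (by omega), if_neg (by omega), if_neg (by omega),
        show q - (j - i) + 1 + (j - i - 1) = q by omega] at this
      exact hne this
    · intro t ht
      split_ifs
      · exact hw.edge_mem t (by omega)
      · exact hw.edge_mem _ (by omega)
    · intro t ht
      split_ifs
      · exact hw.edge_ne t (by omega)
      · exact hw.edge_ne _ (by omega)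
    · intro t ht
      by_cases h : t ≤ i
      · simpa [h] using hw.left_mem t (by omega)
      · by_cases h' : t = i + 1
        · subst h'
          simpa [show i + 1 + (j - i - 1) = j by omega] using hzj
        · simpa [h, h'] using hw.left_mem _ (by omega)
    · intro t ht
      by_cases h : t < i
      · simpa [h.le, show t + 1 ≤ i by omega] using hw.right_mem t (by omega)
      · by_cases h' : t = i
        · subst h'
          simpa using hzi
        · have := hw.right_mem (t + (j - i - 1)) (by omega)
          rw [if_neg (by omega), if_neg (by omega), if_neg (by omega),
            show t + 1 + (j - i - 1) = t + (j - i - 1) + 1 by omega]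
          exact this
    · rw [if_neg (by omega), if_neg (by omega),
        show q - (j - i) + 1 + (j - i - 1) = q by omega]
      exact hq
  have hed : ∀ j, 0 < j → j < q - 1 → Disjoint e (f j) := by
    intro j hj0 hj
    refine Set.disjoint_left.2 fun z hze hzj => ?_
    -- Since z lies in e, either the walk up to z or, when z = v 0, the walk from z on is a shorter
    -- walk with both ends in e.
    by_cases hz : z = v 0
    · have := ih (q - j) (by omega) (fun t => if t = 0 then z else v (t + j))
        (fun t => f (t + j)) ⟨fun t ht => hw.edge_mem _ (by omega),
          fun t ht => hw.edge_ne _ (by omega), ?_, ?_⟩ (by simpa using hze) ?_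
      · rw [if_pos rfl, if_neg (by omega), show q - j + j = q by omega, hz] at this
        exact hne this
      · intro t ht
        by_cases h : t = 0
        · subst h; simpa using hzj
        · simpa [h] using hw.left_mem (t + j) (by omega)
      · intro t ht
        have := hw.right_mem (t + j) (by omega)
        rw [if_neg (by omega), show t + 1 + j = t + j + 1 by omega]
        exact this
      · rw [if_neg (by omega), show q - j + j = q by omega]
        exact hq
    · have := ih (j + 1) (by omega) (fun t => if t ≤ j then v t else z) f
        ⟨fun t ht => hw.edge_mem _ (by omega), fun t ht => hw.edge_ne _ (by omega), ?_, ?_⟩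
        (by simpa using h0) (by simpa using hze)
      · simp only [zero_le, if_true, add_le_iff_nonpos_right, nonpos_iff_eq_zero, one_ne_zero,
          if_false] at this
        exact hz this.symm
      · intro t ht
        simpa [show t ≤ j by omega] using hw.left_mem t (by omega)
      · intro t ht
        by_cases h : t = j
        · subst h; simpa using hzj
        · simpa [show t + 1 ≤ j by omega] using hw.right_mem t (by omega)
  have inter : ∀ {a b : Set α} {x : α}, a ∈ H.edgeSet → b ∈ H.edgeSet → a ≠ b → x ∈ a → x ∈ b →
      a ∩ b = {x} := by
    intro a b x ha hb hab hxa hxb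
    ext z
    simp only [Set.mem_inter_iff, Set.mem_singleton_iff]
    constructor
    · rintro ⟨hza, hzb⟩
      exact hH.eq_of_mem_inter ha hb hab hza hxa hzb hxb
    · rintro rfl
      exact ⟨hxa, hxb⟩
  have hg : ∀ i < q, Function.update f q e i = f i := fun i hi =>
    Function.update_of_ne (by omega) ..
  refine hH q v (Function.update f q e) ⟨hq0, ⟨?_, ?_, ?_, ?_, ?_, ?_, ?_, ?_⟩, ?_, ?_, ?_, ?_,
    ?_, ?_, ?_⟩
  · intro i hi
    rcases hi.eq_or_lt with rfl | hi
    · exact H.subset_vertexSet_of_mem_edgeSet' he hq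
    · exact H.subset_vertexSet_of_mem_edgeSet' (hw.edge_mem i hi) (hw.left_mem i hi)
  · intro i hi
    rw [hg i hi]; exact hw.edge_mem i hi
  · intro i hi j hj hij
    simp only [Set.mem_Iic] at hi hj
    rcases lt_trichotomy i j with h | h | h
    · exact absurd hij (hvinj i j h hj)
    · exact h
    · exact absurd hij.symm (hvinj j i h hi)
  · intro i hi j hj hij
    simp only [Set.mem_Iio] at hi hj
    rw [hg i hi, hg j hj] at hij
    rcases lt_trichotomy i j with h | h | h
    · exact absurd hij (heinj i j h hj)
    · exact h
    · exact absurd hij.symm (heinj j i h hi)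
  · intro i hi
    rw [hg i hi]; exact hw.left_mem i hi
  · intro i hi
    rw [hg i hi]; exact hw.right_mem i hi
  · intro i hi
    rw [hg i (by omega), hg (i + 1) hi]
    exact inter (hw.edge_mem i (by omega)) (hw.edge_mem _ hi) (heinj i (i + 1) (by omega) hi)
      (hw.right_mem i (by omega)) (hw.left_mem _ hi)
  · intro i j hij hj
    rw [hg i (by omega), hg j hj]
    exact hdisj i j hij hj
  · rw [Function.update_self]; exact he
  · intro i hi
    rw [Function.update_self, hg i hi]; exact (hw.edge_ne i hi).symm
  · rw [Function.update_self]; exact h0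
  · rw [Function.update_self]; exact hq
  · intro _
    rw [Function.update_self, hg 0 hq0]
    exact inter he (hw.edge_mem 0 hq0) (hw.edge_ne 0 hq0).symm h0 (hw.left_mem 0 hq0)
  · intro _
    rw [Function.update_self, hg (q - 1) (by omega)]
    have := hw.right_mem (q - 1) (by omega)
    rw [Nat.sub_add_cancel hq0] at this
    exact inter he (hw.edge_mem _ (by omega)) (hw.edge_ne _ (by omega)).symm hq this
  · intro j hj0 hj
    rw [Function.update_self, hg j (by omega)]
    exact hed j hj0 hj

/-- The vertex set as a finset. -/
noncomputable def vertexFinset (H : Hypergraph α) [Fintype H.vertexSet] : Finset α :=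
  H.vertexSet.toFinset

open Classical in
/-- The edges as a finset of finsets. -/
noncomputable def edgeFinset (H : Hypergraph α) [Fintype H.vertexSet] : Finset (Finset α) :=
  {s ∈ H.vertexFinset.powerset | (s : Set α) ∈ H.edgeSet}

variable [Fintype H.vertexSet]

@[simp]
theorem mem_vertexFinset {x : α} : x ∈ H.vertexFinset ↔ x ∈ H.vertexSet := by
  simp [vertexFinset]

theorem mem_edgeFinset {s : Finset α} : s ∈ H.edgeFinset ↔ (s : Set α) ∈ H.edgeSet := by
  classical
  rw [edgeFinset, Finset.mem_filter, Finset.mem_powerset, and_iff_right_iff_imp]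
  exact fun hs x hx => mem_vertexFinset.2 (H.subset_vertexSet_of_mem_edgeSet' hs hx)

theorem exists_coe_of_mem_edgeSet {e : Set α} (he : e ∈ H.edgeSet) :
    ∃ s ∈ H.edgeFinset, (s : Set α) = e := by
  have hfin : e.Finite := (Set.toFinite H.vertexSet).subset (H.subset_vertexSet_of_mem_edgeSet' he)
  exact ⟨hfin.toFinset, mem_edgeFinset.2 (by simpa using he), by simp⟩

theorem IsConnected.reflTransGen (hH : H.IsConnected) {x y : α} (hx : x ∈ H.vertexSet)
    (hy : y ∈ H.vertexSet) : ReflTransGen (EdgeLink H.edgeFinset) x y := by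
  obtain ⟨q, v, e, hp, rfl, rfl⟩ := hH x hx y hy
  have : ∀ i ≤ q, ReflTransGen (EdgeLink H.edgeFinset) (v 0) (v i) := by
    intro i
    induction i with
    | zero => intro _; rfl
    | succ i ih =>
      intro hi
      obtain ⟨s, hs, hse⟩ := exists_coe_of_mem_edgeSet (hp.edge_mem i hi)
      refine (ih (by omega)).tail ⟨s, hs, ?_, ?_⟩
      · rw [← Finset.mem_coe, hse]; exact hp.left_mem i hi
      · rw [← Finset.mem_coe, hse]; exact hp.right_mem i hi
  exact this q le_rfl

theorem exists_walk [DecidableEq α] {e : Finset α} {x y : α}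
    (h : ReflTransGen (EdgeLink (H.edgeFinset.erase e)) x y) :
    ∃ q v f, H.IsWalkAvoiding e q v f ∧ v 0 = x ∧ v q = y := by
  induction h with
  | refl => exact ⟨0, fun _ => x, fun _ => ∅, ⟨by simp, by simp, by simp, by simp⟩, rfl, rfl⟩
  | tail _ hbc ih =>
    rename_i b c _
    obtain ⟨q, v, f, hw, hv0, hvq⟩ := ih
    obtain ⟨s, hs, hbs, hcs⟩ := hbc
    obtain ⟨hse, hs⟩ := Finset.mem_erase.1 hs
    refine ⟨q + 1, Function.update v (q + 1) c, Function.update f q (s : Set α),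
      ⟨?_, ?_, ?_, ?_⟩, ?_, by simp⟩
    · intro i hi
      by_cases h : i = q
      · subst h; simpa using mem_edgeFinset.1 hs
      · simpa [h] using hw.edge_mem i (by omega)
    · intro i hi
      by_cases h : i = q
      · subst h; simpa using hse
      · simpa [h] using hw.edge_ne i (by omega)
    · intro i hi
      by_cases h : i = q
      · subst h; simpa [hvq] using hbs
      · simpa [h, show i ≠ q + 1 by omega] using hw.left_mem i (by omega)
    · intro i hi
      by_cases h : i = q
      · subst h; simpa using hcs
      · simpa [h] using hw.right_mem i (by omega)
    · simpa using hv0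

theorem IsSupertree.isHypertree [DecidableEq α] (hH : H.IsSupertree) {k : ℕ}
    (hk : H.IsUniform k) : IsHypertree k H.vertexFinset H.edgeFinset where
  card_edge e he := by
    have := hk _ (mem_edgeFinset.1 he)
    rwa [Set.ncard_coe_finset] at this
  subset e he x hx := mem_vertexFinset.2
    (H.subset_vertexSet_of_mem_edgeSet' (mem_edgeFinset.1 he) hx)
  nonempty := by
    obtain ⟨x, hx⟩ := hH.nonempty
    exact ⟨x, mem_vertexFinset.2 hx⟩
  bridge e he x hx y hy h := by
    obtain ⟨q, v, f, hw, rfl, rfl⟩ := exists_walk h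
    exact hH.acyclic.eq_of_walk (mem_edgeFinset.1 he) q v f hw hx hy
  connected x hx y hy :=
    hH.connected.reflTransGen (mem_vertexFinset.1 hx) (mem_vertexFinset.1 hy)

end Hypergraph

/-! ### Hypertrees without branching are paths -/

/-- A trail through `q` distinct edges. -/
structure IsEdgePath {α : Type*} (V : Finset α) (E : Finset (Finset α)) (q : ℕ) (v : ℕ → α)
    (e : ℕ → Finset α) : Prop where
  start_mem : v 0 ∈ V
  edge_mem : ∀ i < q, e i ∈ E
  edge_inj : ∀ i < q, ∀ j < q, e i = e j → i = j
  left_mem : ∀ i < q, v i ∈ e i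
  right_mem : ∀ i < q, v (i + 1) ∈ e i
  vertex_ne : ∀ i < q, v i ≠ v (i + 1)

namespace IsEdgePath

variable {α : Type*} {k : ℕ} {V : Finset α} {E : Finset (Finset α)}
  {q : ℕ} {v : ℕ → α} {e : ℕ → Finset α}

theorem change_last (hp : IsEdgePath V E (q + 1) v e) {z : α} (hz : z ∈ e q) (hzv : z ≠ v q) :
    IsEdgePath V E (q + 1) (Function.update v (q + 1) z) e := by
  refine ⟨by simpa using hp.start_mem, hp.edge_mem, hp.edge_inj, ?_, ?_, ?_⟩
  · intro i hi
    simpa [show i ≠ q + 1 by omega] using hp.left_mem i hi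
  · intro i hi
    by_cases h : i = q
    · subst h; simpa using hz
    · simpa [h] using hp.right_mem i hi
  · intro i hi
    by_cases h : i = q
    · subst h; simpa using hzv.symm
    · simpa [h, show i ≠ q + 1 by omega] using hp.vertex_ne i hi

variable [DecidableEq α]

theorem extend (hp : IsEdgePath V E q v e) (hT : IsHypertree k V E) (hk : 2 ≤ k) {f : Finset α}
    (hf : f ∈ E) (hfe : ∀ i < q, f ≠ e i) (hv : v q ∈ f) :
    ∃ v' e', IsEdgePath V E (q + 1) v' e' := by
  obtain ⟨z, hz, hzv⟩ := Finset.exists_mem_ne (s := f) (by rw [hT.card_edge f hf]; omega) (v q)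
  refine ⟨Function.update v (q + 1) z, Function.update e q f, ?_, ?_, ?_, ?_, ?_, ?_⟩
  · simpa using hp.start_mem
  · intro i hi
    by_cases h : i = q
    · subst h; simpa using hf
    · simpa [h] using hp.edge_mem i (by omega)
  · intro i hi j hj
    by_cases h : i = q <;> by_cases h' : j = q
    · intro _; omega
    · subst h
      simp only [Function.update_self, ne_eq, h', not_false_eq_true, Function.update_of_ne]
      exact fun h => absurd h (hfe j (by omega))
    · subst h'
      simp only [Function.update_self, ne_eq, h, not_false_eq_true, Function.update_of_ne]
      exact fun h => absurd h.symm (hfe i (by omega))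
    · simpa [h, h'] using hp.edge_inj i (by omega) j (by omega)
  · intro i hi
    by_cases h : i = q
    · subst h; simpa using hv
    · simpa [h, show i ≠ q + 1 by omega] using hp.left_mem i (by omega)
  · intro i hi
    by_cases h : i = q
    · subst h; simpa using hz
    · simpa [h] using hp.right_mem i (by omega)
  · intro i hi
    by_cases h : i = q
    · subst h; simpa using hzv.symm
    · simpa [h, show i ≠ q + 1 by omega] using hp.vertex_ne i (by omega)

theorem reverse (hp : IsEdgePath V E (q + 1) v e) (hT : IsHypertree k V E) :
    IsEdgePath V E (q + 1) (fun i => v (q + 1 - i)) (fun i => e (q - i)) := by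
  refine ⟨?_, ?_, ?_, ?_, ?_, ?_⟩
  · exact hT.subset _ (hp.edge_mem q (by omega)) (hp.right_mem q (by omega))
  · exact fun i hi => hp.edge_mem _ (by omega)
  · intro i hi j hj hij
    have := hp.edge_inj _ (by omega) _ (by omega) hij
    omega
  · intro i hi
    have := hp.right_mem (q - i) (by omega)
    rwa [show q - i + 1 = q + 1 - i by omega] at this
  · intro i hi
    have := hp.left_mem (q - i) (by omega)
    rwa [show q - i = q + 1 - (i + 1) by omega] at this ⊢
  · intro i hi
    have := hp.vertex_ne (q - i) (by omega)
    rw [show q - i + 1 = q + 1 - i by omega] at this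
    simpa [show q + 1 - (i + 1) = q - i by omega] using this.symm

theorem extend_of_mem_last (hp : IsEdgePath V E (q + 1) v e) (hT : IsHypertree k V E)
    (hk : 2 ≤ k) {f : Finset α} (hf : f ∈ E) (hfe : ∀ i < q + 1, f ≠ e i) {z : α} (hzf : z ∈ f)
    (hz : z ∈ e q) (hzv : z ≠ v q) : ∃ v' e', IsEdgePath V E (q + 2) v' e' :=
  (hp.change_last hz hzv).extend hT hk hf hfe (by simpa using hzf)

end IsEdgePath

namespace IsHypertree

variable {α : Type*} [DecidableEq α] {k : ℕ} {V : Finset α} {E : Finset (Finset α)}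

/-- A hypertree whose vertices lie in at most two edges and whose edges have at most two vertices
in common with other edges is traversed by a single path. -/
theorem exists_edgePath_cover (hT : IsHypertree k V E) (hk : 2 ≤ k)
    (hvert : ∀ v, ∀ e₁ ∈ E, ∀ e₂ ∈ E, ∀ e₃ ∈ E, v ∈ e₁ → v ∈ e₂ → v ∈ e₃ →
      e₁ ≠ e₂ → e₁ ≠ e₃ → e₂ ≠ e₃ → False)
    (hedge : ∀ e ∈ E, ∀ u₁ ∈ e, ∀ u₂ ∈ e, ∀ u₃ ∈ e, u₁ ≠ u₂ → u₁ ≠ u₃ → u₂ ≠ u₃ →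
      (∀ u, u = u₁ ∨ u = u₂ ∨ u = u₃ → ∃ f ∈ E, f ≠ e ∧ u ∈ f) → False) :
    ∃ q v e, IsEdgePath V E q v e ∧ (∀ f ∈ E, ∃ i < q, f = e i) ∧
      ∀ x ∈ V, x = v 0 ∨ ∃ i < q, x ∈ e i := by
  classical
  obtain ⟨r, hr⟩ := hT.nonempty
  have hbound : ∀ q v e, IsEdgePath V E q v e → q ≤ E.card := by
    intro q v e hp
    have := Finset.card_le_card_of_injOn (s := Finset.range q) (t := E) e
      (fun i hi => hp.edge_mem i (Finset.mem_range.1 hi))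
      (fun i hi j hj hij => hp.edge_inj i (by simpa using hi) j (by simpa using hj) hij)
    simpa using this
  let P : ℕ → Prop := fun q => ∃ v e, IsEdgePath V E q v e
  have hP0 : P 0 := ⟨fun _ => r, fun _ => ∅, hr, by simp, by simp, by simp, by simp, by simp⟩
  -- A longest trail; its length is bounded by the number of edges.
  obtain ⟨v, e, hp⟩ : P (Nat.findGreatest P E.card) := Nat.findGreatest_spec (Nat.zero_le _) hP0
  have hmax : ¬ P (Nat.findGreatest P E.card + 1) := by
    rintro ⟨v', e', hp'⟩
    have := Nat.le_findGreatest (P := P) (hbound _ _ _ hp') ⟨v', e', hp'⟩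
    omega
  generalize Nat.findGreatest P E.card = q at hp hmax
  -- An edge outside the trail cannot meet it: it would extend the trail at an end, or create a
  -- third edge at a cut vertex or a third branching vertex in an inner edge.
  have touch : ∀ f ∈ E, ∀ z ∈ f, (z = v 0 ∨ ∃ i < q, z ∈ e i) → ∃ i < q, f = e i := by
    intro f hf z hzf hz
    by_contra hcon
    have hfe : ∀ i < q, f ≠ e i := fun i hi h => hcon ⟨i, hi, h⟩
    obtain _ | q := q
    · rcases hz with rfl | ⟨i, hi, _⟩
      · exact hmax (hp.extend hT hk hf hfe hzf)
      · omega
    obtain ⟨i, hi, hzi⟩ : ∃ i < q + 1, z ∈ e i := by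
      rcases hz with rfl | h
      · exact ⟨0, by omega, hp.left_mem 0 (by omega)⟩
      · exact h
    have cut : ∀ j, j + 1 < q + 1 → z ≠ v (j + 1) := by
      rintro j hj rfl
      refine hvert _ _ (hp.edge_mem j (by omega)) _ (hp.edge_mem (j + 1) hj) f hf
        (hp.right_mem j (by omega)) (hp.left_mem (j + 1) hj) hzf ?_ (hfe _ (by omega)).symm
        (hfe _ hj).symm
      intro h
      have := hp.edge_inj _ (by omega) _ hj h
      omega
    have hlast : z ∈ e q → z = v q := by
      intro h
      by_contra hne
      exact hmax (hp.extend_of_mem_last hT hk hf hfe hzf h hne)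
    have hfirst : z ∈ e 0 → z = v 1 := by
      intro h
      by_contra hne
      refine hmax ((hp.reverse hT).extend_of_mem_last hT hk hf (fun i hi => hfe _ (by omega)) hzf
        (by simpa using h) (by simpa using hne))
    by_cases hi0 : i = 0
    · subst hi0
      have h1 := hfirst hzi
      by_cases hq : q = 0
      · subst hq
        exact hp.vertex_ne 0 (by omega) ((hlast hzi).symm.trans h1)
      · exact cut 0 (by omega) h1
    obtain ⟨j, rfl⟩ := Nat.exists_eq_succ_of_ne_zero hi0
    simp only [Nat.succ_eq_add_one] at hi hzi
    by_cases hiq : j + 1 = q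
    · exact cut j hi (by rw [hiq]; exact hlast (hiq ▸ hzi))
    · have c1 := cut j hi
      have c2 := cut (j + 1) (by omega)
      refine hedge (e (j + 1)) (hp.edge_mem _ hi) _ (hp.left_mem _ hi) _ (hp.right_mem _ hi) z hzi
        (hp.vertex_ne _ hi) c1.symm c2.symm ?_
      rintro u (rfl | rfl | rfl)
      · refine ⟨e j, hp.edge_mem j (by omega), fun h => ?_, hp.right_mem j (by omega)⟩
        have := hp.edge_inj _ (by omega) _ (by omega) h
        omega
      · refine ⟨e (j + 2), hp.edge_mem _ (by omega), fun h => ?_, hp.left_mem _ (by omega)⟩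
        have := hp.edge_inj _ (by omega) _ (by omega) h
        omega
      · exact ⟨f, hf, hfe _ hi, hzf⟩
  have hcover : ∀ x ∈ V, x = v 0 ∨ ∃ i < q, x ∈ e i := by
    intro x hx
    have h := hT.connected _ hp.start_mem x hx
    induction h with
    | refl => exact Or.inl rfl
    | tail _ hbc ih =>
      obtain ⟨f, hf, hbf, hcf⟩ := hbc
      obtain ⟨i, hi, rfl⟩ := touch f hf _ hbf (ih (hT.subset f hf hbf))
      exact Or.inr ⟨i, hi, hcf⟩
  refine ⟨q, v, e, hp, fun f hf => ?_, hcover⟩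
  obtain ⟨z, hz⟩ := Finset.card_pos.1 (show 0 < f.card by rw [hT.card_edge f hf]; omega)
  exact touch f hf z hz (hcover z (hT.subset f hf hz))

end IsHypertree

theorem Finset.exists_image_range_eq {α : Type*} [DecidableEq α] {s : Finset α} {d : ℕ}
    (hs : s.card = d) {a : α} (ha : a ∈ s) :
    ∃ g : ℕ → α, g 0 = a ∧ (Finset.range d).image g = s := by
  refine ⟨fun i => if i = 0 then a else (s.erase a).toList.getD (i - 1) a, by simp, ?_⟩
  have hlen : (s.erase a).toList.length + 1 = d := by
    rw [Finset.length_toList, Finset.card_erase_add_one ha, hs]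
  ext x
  simp only [Finset.mem_image, Finset.mem_range]
  constructor
  · rintro ⟨i, hi, rfl⟩
    split_ifs with h
    · exact ha
    · rw [List.getD_eq_getElem _ _ (by omega)]
      exact Finset.mem_of_mem_erase (Finset.mem_toList.1 (List.getElem_mem _))
  · intro hx
    by_cases hxa : x = a
    · exact ⟨0, by omega, by simp [hxa]⟩
    · have : x ∈ (s.erase a).toList := Finset.mem_toList.2 (Finset.mem_erase.2 ⟨hxa, hx⟩)
      obtain ⟨i, hi, rfl⟩ := List.getElem_of_mem this
      exact ⟨i + 1, by omega, by
        rw [if_neg (by omega), Nat.add_sub_cancel, List.getD_eq_getElem _ _ hi]⟩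

namespace IsEdgePath

variable {α : Type*} [DecidableEq α] {k : ℕ} {V : Finset α} {E : Finset (Finset α)}
  {q : ℕ} {v : ℕ → α} {e : ℕ → Finset α}

/-- The vertices of a path can be numbered so that the edges become intervals. -/
theorem exists_labelling (hp : IsEdgePath V E q v e) (hT : IsHypertree k V E) (hk : 2 ≤ k) :
    ∃ φ : ℕ → α, φ 0 = v 0 ∧
      ∀ i < q, φ '' Set.Icc (i * (k - 1)) ((i + 1) * (k - 1)) = (e i : Set α) := by
  have hd : 0 < k - 1 := by omega
  have hG : ∀ i, ∃ g : ℕ → α, g 0 = v i ∧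
      (i < q → (Finset.range (k - 1)).image g = (e i).erase (v (i + 1))) := by
    intro i
    by_cases hi : i < q
    · obtain ⟨g, hg0, hg⟩ := Finset.exists_image_range_eq (d := k - 1)
        (s := (e i).erase (v (i + 1))) (a := v i)
        (by rw [Finset.card_erase_of_mem (hp.right_mem i hi), hT.card_edge _ (hp.edge_mem i hi)])
        (Finset.mem_erase.2 ⟨hp.vertex_ne i hi, hp.left_mem i hi⟩)
      exact ⟨g, hg0, fun _ => hg⟩
    -- For i = q the constant v q labels the far end of the last edge. In general edge i enumerates
    -- its vertices other than v (i + 1), which receives label 0 of block i + 1.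
    · exact ⟨fun _ => v i, rfl, fun h => absurd h hi⟩
  choose G hG0 hG using hG
  refine ⟨fun x => G (x / (k - 1)) (x % (k - 1)), by simp [hG0], fun i hi => ?_⟩
  have hcut : ∀ j, G (j * (k - 1) / (k - 1)) (j * (k - 1) % (k - 1)) = v j := by
    intro j
    rw [Nat.mul_div_cancel _ hd, Nat.mul_mod_left, hG0]
  have hin : ∀ s < k - 1, G ((i * (k - 1) + s) / (k - 1)) ((i * (k - 1) + s) % (k - 1)) = G i s := by
    intro s hs
    rw [mul_comm i, Nat.mul_add_div hd, Nat.div_eq_of_lt hs, Nat.mul_add_mod, Nat.mod_eq_of_lt hs,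
      add_zero]
  ext x
  simp only [Set.mem_image, Set.mem_Icc, Finset.mem_coe]
  constructor
  · rintro ⟨t, ⟨h1, h2⟩, rfl⟩
    rcases h2.eq_or_lt with rfl | h2
    · rw [hcut]; exact hp.right_mem i hi
    · obtain ⟨s, rfl⟩ := Nat.exists_eq_add_of_le h1
      rw [add_mul, one_mul] at h2
      rw [hin s (by omega)]
      exact Finset.mem_of_mem_erase
        (hG i hi ▸ Finset.mem_image_of_mem _ (Finset.mem_range.2 (by omega)))
  · intro hx
    by_cases hxv : x = v (i + 1)
    · exact ⟨(i + 1) * (k - 1), ⟨by rw [add_mul]; omega, le_rfl⟩, by rw [hcut, hxv]⟩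
    · have : x ∈ (e i).erase (v (i + 1)) := Finset.mem_erase.2 ⟨hxv, hx⟩
      rw [← hG i hi] at this
      obtain ⟨s, hs, rfl⟩ := Finset.mem_image.1 this
      rw [Finset.mem_range] at hs
      exact ⟨i * (k - 1) + s, ⟨by omega, by rw [add_mul]; omega⟩, hin s hs⟩

end IsEdgePath

namespace Hypergraph

theorem isIsomorphic_hyperpath_of_edgePath {α : Type*} [DecidableEq α] {H : Hypergraph α}
    [Fintype H.vertexSet] {k q : ℕ} (hk : 2 ≤ k)
    (hT : IsHypertree k H.vertexFinset H.edgeFinset) {v : ℕ → α} {e : ℕ → Finset α}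
    (hp : IsEdgePath H.vertexFinset H.edgeFinset q v e)
    (hE : ∀ f ∈ H.edgeFinset, ∃ i < q, f = e i)
    (hV : ∀ x ∈ H.vertexFinset, x = v 0 ∨ ∃ i < q, x ∈ e i) :
    H.IsIsomorphic (hyperpath (Fintype.card H.vertexSet) k) := by
  obtain ⟨φ, hφ0, hφ⟩ := hp.exists_labelling hT hk
  have hq : H.edgeFinset.card = q := by
    have : H.edgeFinset = (Finset.range q).image e := by
      ext f
      simp only [Finset.mem_image, Finset.mem_range]
      constructor
      · intro hf
        obtain ⟨i, hi, rfl⟩ := hE f hf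
        exact ⟨i, hi, rfl⟩
      · rintro ⟨i, hi, rfl⟩
        exact hp.edge_mem i hi
    rw [this, Finset.card_image_of_injOn, Finset.card_range]
    intro i hi j hj hij
    exact hp.edge_inj i (by simpa using hi) j (by simpa using hj) hij
  have hn : Fintype.card H.vertexSet = q * (k - 1) + 1 := by
    rw [← hq, ← hT.card_vertices hk, vertexFinset, Set.toFinset_card]
  rw [hn]
  set n := q * (k - 1) + 1 with hndef
  have hlt : ∀ i, (i + 1) * (k - 1) < n ↔ i < q := by
    intro i
    rw [hndef, Nat.lt_succ_iff]
    constructor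
    · intro h
      exact Nat.lt_of_succ_le (Nat.le_of_mul_le_mul_right h (by omega))
    · intro h
      exact Nat.mul_le_mul_right _ h
  have hmaps : ∀ t < n, φ t ∈ H.vertexSet := by
    intro t ht
    rcases Nat.eq_zero_or_pos t with rfl | ht0
    · rw [hφ0]; exact mem_vertexFinset.1 hp.start_mem
    · have hd : 0 < k - 1 := by omega
      have hi : t / (k - 1) < q ∨ t = q * (k - 1) := by
        rcases (Nat.lt_succ_iff.1 ht).eq_or_lt with h | h
        · exact Or.inr h
        · exact Or.inl ((Nat.div_lt_iff_lt_mul hd).2 h)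
      obtain ⟨i, hi, h1, h2⟩ : ∃ i < q, i * (k - 1) ≤ t ∧ t ≤ (i + 1) * (k - 1) := by
        rcases hi with hi | rfl
        · exact ⟨_, hi, Nat.div_mul_le_self _ _, by
            have := Nat.lt_div_mul_add hd (a := t); rw [add_mul]; omega⟩
        · obtain ⟨p, rfl⟩ : ∃ p, q = p + 1 :=
            Nat.exists_eq_succ_of_ne_zero (by rintro rfl; simp at ht0)
          exact ⟨p, by omega, by rw [add_mul]; omega, le_rfl⟩
      have : φ t ∈ (e i : Set α) := by rw [← hφ i hi]; exact ⟨t, ⟨h1, h2⟩, rfl⟩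
      exact H.subset_vertexSet_of_mem_edgeSet' (mem_edgeFinset.1 (hp.edge_mem i hi)) this
  let ψ : (hyperpath n k).vertexSet → H.vertexSet := fun t => ⟨φ t, hmaps t t.2⟩
  have hsurj : Function.Surjective ψ := by
    rintro ⟨x, hx⟩
    rcases hV x (mem_vertexFinset.2 hx) with rfl | ⟨i, hi, hxi⟩
    · exact ⟨⟨0, by show 0 < n; omega⟩, Subtype.ext hφ0⟩
    · rw [← Finset.mem_coe, ← hφ i hi] at hxi
      obtain ⟨t, ht, rfl⟩ := hxi
      exact ⟨⟨t, lt_of_le_of_lt ht.2 ((hlt i).2 hi)⟩, rfl⟩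
  -- Injectivity of the numbering comes from counting: ψ is onto and both sides have q(k - 1) + 1
  -- elements.
  have hbij : Function.Bijective ψ := by
    rw [Fintype.bijective_iff_surjective_and_card]
    refine ⟨hsurj, ?_⟩
    rw [hn]
    exact (Fintype.card_congr (Equiv.refl (Set.Iio n))).trans (by simp)
  refine ⟨(Equiv.ofBijective ψ hbij).symm, fun s => ?_⟩
  obtain ⟨r, rfl⟩ : ∃ r, s = ψ '' r := ⟨ψ ⁻¹' s, (Set.image_preimage_eq s hsurj).symm⟩
  have h1 : (Equiv.ofBijective ψ hbij).symm '' (ψ '' r) = r :=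
    (Equiv.ofBijective ψ hbij).symm_image_image r
  have h2 : Subtype.val '' (ψ '' r) = φ '' (Subtype.val '' r) := by
    rw [Set.image_image, Set.image_image]
  rw [h1, h2]
  have hinj : Set.InjOn φ (Set.Iio n) := by
    intro a ha b hb hab
    exact congrArg Subtype.val (hbij.1 (a₁ := ⟨a, ha⟩) (a₂ := ⟨b, hb⟩) (Subtype.ext hab))
  constructor
  · intro h
    obtain ⟨f, hf, hfe⟩ := exists_coe_of_mem_edgeSet h
    obtain ⟨i, hi, rfl⟩ := hE f hf
    rw [← hφ i hi] at hfe
    refine ⟨i, (hlt i).2 hi, ((hinj.image_eq_image_iff ?_ ?_).1 hfe).symm⟩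
    · exact fun t ht => lt_of_le_of_lt ht.2 ((hlt i).2 hi)
    · rintro _ ⟨t, _, rfl⟩
      exact t.2
  · rintro ⟨i, hi, h⟩
    rw [h, hφ i ((hlt i).1 hi)]
    exact mem_edgeFinset.1 (hp.edge_mem i ((hlt i).1 hi))

end Hypergraph

/-! ### Positive eigenvectors for the spectral radius -/

namespace Matrix

theorem IsHermitian.mem_spectrum_map_ofReal {ι : Type*} [Fintype ι] [DecidableEq ι]
    {A : Matrix ι ι ℝ} (hA : A.IsHermitian) (z : ℂ) :
    z ∈ spectrum ℂ (A.map Complex.ofReal) ↔ ∃ i, z = hA.eigenvalues i := by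
  rw [Matrix.mem_spectrum_iff_isRoot_charpoly,
    show A.map Complex.ofReal = A.map Complex.ofRealHom from rfl, Matrix.charpoly_map,
    hA.charpoly_eq, Polynomial.map_prod, Polynomial.isRoot_prod]
  simp [sub_eq_zero]

/-- A nonnegative symmetric matrix has a nonnegative eigenvector for its spectral radius. -/
theorem IsHermitian.exists_nonneg_eigenvector {ι : Type*} [Fintype ι] [DecidableEq ι] [Nonempty ι]
    {A : Matrix ι ι ℝ} (hA : A.IsHermitian) (hpos : ∀ i j, 0 ≤ A i j) :
    ∃ (μ : ℝ) (z : ι → ℝ), 0 ≤ μ ∧ (∀ i, 0 ≤ z i) ∧ z ≠ 0 ∧ A *ᵥ z = μ • z ∧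
      spectralRadius ℂ (A.map Complex.ofReal) = ENNReal.ofReal μ := by
  obtain ⟨i₀, hi₀⟩ := Finite.exists_max fun i => |hA.eigenvalues i|
  set μ := |hA.eigenvalues i₀| with hμ
  set u : ι → ℝ := ⇑(hA.eigenvectorBasis i₀) with hu
  have hAu : A *ᵥ u = hA.eigenvalues i₀ • u := hA.mulVec_eigenvectorBasis i₀
  have hu0 : u ≠ 0 := by
    intro h
    have := hA.eigenvectorBasis.orthonormal.ne_zero i₀
    exact this (by ext j; exact congrFun h j)
  -- As μ bounds all eigenvalues, μ - A is positive semidefinite. The vector |u| makes its quadratic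
  -- form vanish, so |u| lies in its kernel.
  have hpsd : (μ • (1 : Matrix ι ι ℝ) - A).PosSemidef := by
    rw [Matrix.posSemidef_iff_isHermitian_and_spectrum_nonneg]
    refine ⟨?_, ?_⟩
    · refine IsHermitian.sub ?_ hA
      rw [IsHermitian, conjTranspose_smul, conjTranspose_one]
      simp
    · intro r hr
      rw [← Algebra.algebraMap_eq_smul_one, ← spectrum.singleton_sub_eq] at hr
      obtain ⟨_, rfl, s, hs, rfl⟩ := hr
      rw [hA.spectrum_real_eq_range_eigenvalues] at hs
      obtain ⟨i, rfl⟩ := hs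
      exact sub_nonneg.2 ((le_abs_self _).trans (hi₀ i))
  refine ⟨μ, fun i => |u i|, abs_nonneg _, fun i => abs_nonneg _, ?_, ?_, ?_⟩
  · intro h
    exact hu0 (by ext i; simpa using congrFun h i)
  · set z : ι → ℝ := fun i => |u i| with hz
    have hle : μ * (z ⬝ᵥ z) ≤ z ⬝ᵥ (A *ᵥ z) := by
      simp only [dotProduct, Finset.mul_sum]
      refine Finset.sum_le_sum fun i _ => ?_
      have h1 : |(A *ᵥ u) i| ≤ (A *ᵥ z) i := by
        simp only [mulVec, dotProduct]
        refine (Finset.abs_sum_le_sum_abs _ _).trans (Finset.sum_le_sum fun j _ => ?_)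
        rw [abs_mul, abs_of_nonneg (hpos i j)]
      rw [hAu, Pi.smul_apply, smul_eq_mul, abs_mul] at h1
      calc μ * (z i * z i) = z i * (|hA.eigenvalues i₀| * |u i|) := by rw [hμ, hz]; ring
        _ ≤ z i * (A *ᵥ z) i := mul_le_mul_of_nonneg_left h1 (abs_nonneg _)
    have hzero : star z ⬝ᵥ ((μ • (1 : Matrix ι ι ℝ) - A) *ᵥ z) = 0 := by
      refine le_antisymm ?_ (hpsd.dotProduct_mulVec_nonneg z)
      rw [sub_mulVec, smul_mulVec, one_mulVec, dotProduct_sub, dotProduct_smul, smul_eq_mul,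
        star_trivial]
      linarith
    rw [hpsd.dotProduct_mulVec_zero_iff, sub_mulVec, smul_mulVec, one_mulVec] at hzero
    exact (sub_eq_zero.1 hzero).symm
  · refine le_antisymm (iSup₂_le fun z hz => ?_) ?_
    · obtain ⟨i, rfl⟩ := (hA.mem_spectrum_map_ofReal z).1 hz
      have := hi₀ i
      rw [← enorm_eq_nnnorm, ← ofReal_norm, Complex.norm_real, Real.norm_eq_abs]
      exact ENNReal.ofReal_le_ofReal this
    · have hmem := (hA.mem_spectrum_map_ofReal (hA.eigenvalues i₀ : ℂ)).2 ⟨i₀, rfl⟩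
      refine le_trans ?_ (le_iSup₂ (f := fun k _ => (‖k‖₊ : ENNReal)) _ hmem)
      rw [← enorm_eq_nnnorm, ← ofReal_norm, Complex.norm_real, Real.norm_eq_abs]

end Matrix

namespace Hypergraph

variable {α : Type*} {H : Hypergraph α} [Fintype H.vertexSet] {k : ℕ}

open Classical in
-- Erasing i from each edge also accounts for the zero diagonal, so multiplication by a vector
-- becomes a sum over edges without a case distinction.
theorem IsUniform.adjMatrix_apply (hH : H.IsUniform k) (i j : H.vertexSet) :
    H.adjMatrix i j = ∑ e ∈ H.edgeFinset with (i : α) ∈ e,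
      if (j : α) ∈ e.erase i then 1 / ((k : ℝ) - 1) else 0 := by
  rw [adjMatrix, Matrix.of_apply]
  split_ifs with hij
  · subst hij
    simp
  · have hset : {e : Set α | e ∈ H.edgeSet ∧ (i : α) ∈ e ∧ (j : α) ∈ e} =
        (fun s : Finset α => (s : Set α)) ''
          ({e ∈ H.edgeFinset | (i : α) ∈ e ∧ (j : α) ∈ e} : Finset (Finset α)) := by
      ext e
      simp only [Set.mem_ofPred_eq, Set.mem_image, Finset.mem_coe, Finset.mem_filter]
      constructor
      · rintro ⟨he, h1, h2⟩
        obtain ⟨s, hs, rfl⟩ := exists_coe_of_mem_edgeSet he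
        exact ⟨s, ⟨hs, h1, h2⟩, rfl⟩
      · rintro ⟨s, ⟨hs, h1, h2⟩, rfl⟩
        exact ⟨mem_edgeFinset.1 hs, h1, h2⟩
    rw [hset, finsum_mem_image Finset.coe_injective.injOn, finsum_mem_coe_finset,
      ← Finset.sum_filter, Finset.filter_filter]
    refine Finset.sum_congr ?_ ?_
    · ext e
      simp only [Finset.mem_filter, Finset.mem_erase]
      have : (j : α) ≠ i := fun h => hij (Subtype.ext h.symm)
      tauto
    · intro e he
      have := hH _ (mem_edgeFinset.1 (Finset.mem_filter.1 he).1)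
      rw [this]

open Classical in
theorem IsUniform.adjMatrix_mulVec (hH : H.IsUniform k) (x : α → ℝ) (i : H.vertexSet) :
    (H.adjMatrix.mulVec fun j => x j) i =
      (∑ e ∈ H.edgeFinset with (i : α) ∈ e, (∑ z ∈ e, x z - x i)) / ((k : ℝ) - 1) := by
  simp only [Matrix.mulVec, dotProduct, hH.adjMatrix_apply, Finset.sum_mul]
  rw [Finset.sum_comm, Finset.sum_div]
  refine Finset.sum_congr rfl fun e he => ?_
  obtain ⟨he, hie⟩ := Finset.mem_filter.1 he
  have hsub : e.erase (i : α) ⊆ H.vertexFinset := fun z hz => mem_vertexFinset.2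
    (H.subset_vertexSet_of_mem_edgeSet' (mem_edgeFinset.1 he) (Finset.mem_of_mem_erase hz))
  rw [← Finset.sum_erase_eq_sub hie, Finset.sum_div]
  rw [← Finset.sum_subtype H.vertexFinset (fun z => mem_vertexFinset)
    (fun z => (if z ∈ e.erase (i : α) then 1 / ((k : ℝ) - 1) else 0) * x z),
    ← Finset.sum_subset hsub]
  · exact Finset.sum_congr rfl fun z hz => by rw [if_pos hz]; ring
  · intro z _ hz
    rw [if_neg hz, zero_mul]

open Classical in
/-- A connected uniform hypergraph has a positive eigenvector for its spectral radius. -/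
theorem IsUniform.exists_perron (hH : H.IsUniform k) (hk : 2 ≤ k) (hne : H.vertexSet.Nonempty)
    (hconn : ∀ x ∈ H.vertexSet, ∀ y ∈ H.vertexSet, ReflTransGen (EdgeLink H.edgeFinset) x y) :
    ∃ (lam : ℝ) (x : α → ℝ), 0 ≤ lam ∧ (∀ v ∈ H.vertexSet, 0 < x v) ∧
      (∀ v ∈ H.vertexSet, ∑ e ∈ H.edgeFinset with v ∈ e, (∑ z ∈ e, x z - x v) = lam * x v) ∧
      H.rho = ENNReal.ofReal (lam / ((k : ℝ) - 1)) := by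
  have hk' : (0 : ℝ) < (k : ℝ) - 1 := by
    have : (2 : ℝ) ≤ k := by exact_mod_cast hk
    linarith
  have : Nonempty H.vertexSet := hne.to_subtype
  have hherm : H.adjMatrix.IsHermitian := by
    ext i j
    simp only [Matrix.conjTranspose_apply, star_trivial]
    simp only [adjMatrix, Matrix.of_apply, eq_comm (a := j), and_comm (a := (j : α) ∈ _)]
  have hnonneg : ∀ i j, 0 ≤ H.adjMatrix i j := by
    intro i j
    rw [hH.adjMatrix_apply]
    refine Finset.sum_nonneg fun e _ => ?_
    split_ifs
    · positivity
    · exact le_rfl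
  obtain ⟨μ, z, hμ, hz, hz0, hAz, hrho⟩ := hherm.exists_nonneg_eigenvector hnonneg
  let x : α → ℝ := fun a => if h : a ∈ H.vertexSet then z ⟨a, h⟩ else 0
  have hxz : (fun j : H.vertexSet => x j) = z := by
    ext j
    simp [x]
  have hx : ∀ a, 0 ≤ x a := by
    intro a
    simp only [x]
    split_ifs
    · exact hz _
    · exact le_rfl
  have heq : ∀ v ∈ H.vertexSet,
      ∑ e ∈ H.edgeFinset with v ∈ e, (∑ z ∈ e, x z - x v) = ((k : ℝ) - 1) * μ * x v := by
    intro v hv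
    have h1 := hH.adjMatrix_mulVec x ⟨v, hv⟩
    rw [hxz, hAz, Pi.smul_apply, smul_eq_mul, eq_div_iff hk'.ne'] at h1
    rw [← h1, ← hxz]
    ring
  refine ⟨((k : ℝ) - 1) * μ, x, by positivity, fun v hv => ?_, heq, ?_⟩
  · by_contra hv0
    have hv0 : x v = 0 := le_antisymm (not_lt.1 hv0) (hx v)
    -- A zero entry forces all neighbouring entries to vanish, their sum being zero, and so spreads
    -- through the connected hypergraph.
    have hall : ∀ u, ReflTransGen (EdgeLink H.edgeFinset) v u → x u = 0 := by
      intro u hu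
      induction hu with
      | refl => exact hv0
      | tail _ hbc ih =>
        obtain ⟨f, hf, hb, hc⟩ := hbc
        rename_i b c _
        have h1 := heq b (H.subset_vertexSet_of_mem_edgeSet' (mem_edgeFinset.1 hf) hb)
        simp only [ih, sub_zero, mul_zero] at h1
        rw [Finset.sum_eq_zero_iff_of_nonneg
          fun e _ => Finset.sum_nonneg fun a _ => hx a] at h1
        have h2 := h1 f (Finset.mem_filter.2 ⟨hf, hb⟩)
        rw [Finset.sum_eq_zero_iff_of_nonneg fun a _ => hx a] at h2
        exact h2 c hc
    refine hz0 (funext fun j => ?_)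
    rw [← hxz]
    exact hall j (hconn v hv j j.2)
  · rw [mul_div_assoc, mul_comm, div_mul_cancel₀ _ hk'.ne', ← hrho, rho]

theorem IsIsomorphic.rho_eq {β : Type*} {G : Hypergraph β} [Fintype G.vertexSet]
    (h : G.IsIsomorphic H) : G.rho = H.rho := by
  classical
  obtain ⟨f, hf⟩ := h
  have hadj : ∀ i j, G.adjMatrix i j = H.adjMatrix (f i) (f j) := by
    intro i j
    simp only [adjMatrix, Matrix.of_apply, f.injective.eq_iff]
    split_ifs with hij
    · rfl
    have hpre : ∀ e ∈ G.edgeSet, Subtype.val '' (Subtype.val ⁻¹' e : Set G.vertexSet) = e :=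
      fun e he => by
        rw [Subtype.image_preimage_coe]
        exact Set.inter_eq_right.2 (G.subset_vertexSet_of_mem_edgeSet' he)
    refine finsum_mem_eq_of_bijOn
      (fun e => Subtype.val '' (f '' (Subtype.val ⁻¹' e : Set G.vertexSet))) ⟨?_, ?_, ?_⟩ ?_
    · rintro e ⟨he, hi, hj⟩
      exact ⟨(hf _).1 (by rwa [hpre e he]), ⟨f i, ⟨i, hi, rfl⟩, rfl⟩, ⟨f j, ⟨j, hj, rfl⟩, rfl⟩⟩
    · rintro e ⟨he, -⟩ e' ⟨he', -⟩ hee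
      have := f.injective.image_injective (Subtype.val_injective.image_injective hee)
      rw [← hpre e he, this, hpre e' he']
    · rintro e ⟨he, hi, hj⟩
      have hs : Subtype.val '' (f '' (f ⁻¹' (Subtype.val ⁻¹' e))) = e := by
        rw [Set.image_preimage_eq _ f.surjective, Subtype.image_preimage_coe]
        exact Set.inter_eq_right.2 (H.subset_vertexSet_of_mem_edgeSet' he)
      refine ⟨Subtype.val '' (f ⁻¹' (Subtype.val ⁻¹' e)), ⟨(hf _).2 (by rwa [hs]), ⟨i, hi, rfl⟩,
        ⟨j, hj, rfl⟩⟩, ?_⟩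
      simp only [Set.preimage_image_eq _ Subtype.val_injective]
      exact hs
    · rintro e ⟨he, -⟩
      rw [Set.ncard_image_of_injective _ Subtype.val_injective,
        Set.ncard_image_of_injective _ f.injective,
        ← Set.ncard_image_of_injective _ Subtype.val_injective, hpre e he]
  have hmat : H.adjMatrix.map Complex.ofReal =
      Matrix.reindexAlgEquiv ℂ ℂ f (G.adjMatrix.map Complex.ofReal) := by
    ext i j
    simp [hadj]
  have hspec := AlgEquiv.spectrum_eq (Matrix.reindexAlgEquiv ℂ ℂ f)
    (G.adjMatrix.map Complex.ofReal)
  rw [← hmat] at hspec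
  have key : spectralRadius ℂ (G.adjMatrix.map Complex.ofReal) =
      spectralRadius ℂ (H.adjMatrix.map Complex.ofReal) := by
    simp only [spectralRadius, hspec]
  unfold rho
  convert key

end Hypergraph

/-! ### The profile of the hyperpath -/

namespace Hypergraph

theorem mem_edgeFinset_hyperpath {m k : ℕ} (hk : 2 ≤ k) {s : Finset ℕ} :
    s ∈ (hyperpath (m * (k - 1) + 1) k).edgeFinset ↔
      ∃ i < m, Finset.Icc (i * (k - 1)) ((i + 1) * (k - 1)) = s := by
  rw [mem_edgeFinset]
  constructor
  · rintro ⟨i, hi, h⟩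
    refine ⟨i, ?_, Finset.coe_injective (by rw [h, Finset.coe_Icc])⟩
    exact Nat.lt_of_succ_le (Nat.le_of_mul_le_mul_right (Nat.lt_succ_iff.1 hi) (by omega))
  · rintro ⟨i, hi, rfl⟩
    exact ⟨i, Nat.lt_succ_iff.2 (Nat.mul_le_mul_right _ hi), Finset.coe_Icc _ _⟩

theorem hyperpath_isUniform {m k : ℕ} (hk : 2 ≤ k) :
    (hyperpath (m * (k - 1) + 1) k).IsUniform k := by
  rintro e ⟨i, hi, rfl⟩
  rw [← Finset.coe_Icc, Set.ncard_coe_finset, Nat.card_Icc, add_mul]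
  omega

theorem hyperpath_reflTransGen {m k : ℕ} (hk : 2 ≤ k) {x y : ℕ}
    (hx : x ∈ (hyperpath (m * (k - 1) + 1) k).vertexSet)
    (hy : y ∈ (hyperpath (m * (k - 1) + 1) k).vertexSet) :
    ReflTransGen (EdgeLink (hyperpath (m * (k - 1) + 1) k).edgeFinset) x y := by
  have hd : 0 < k - 1 := by omega
  have key : ∀ t < m * (k - 1) + 1,
      ReflTransGen (EdgeLink (hyperpath (m * (k - 1) + 1) k).edgeFinset) 0 t := by
    intro t
    induction t with
    | zero => intro _; rfl
    | succ t ih =>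
      intro ht
      have h1 := Nat.div_mul_le_self t (k - 1)
      have h2 := Nat.lt_div_mul_add hd (a := t)
      refine (ih (by omega)).tail ⟨_, (mem_edgeFinset_hyperpath hk).2 ⟨t / (k - 1), ?_, rfl⟩, ?_, ?_⟩
      · exact (Nat.div_lt_iff_lt_mul hd).2 (by omega)
      all_goals rw [Finset.mem_Icc, add_mul]; omega
  exact (EdgeLink.symm (key x hx)).trans (key y hy)

theorem sum_edges_hyperpath {m k : ℕ} (hk : 2 ≤ k) (x : ℕ → ℝ) (v : ℕ) :
    ∑ e ∈ (hyperpath (m * (k - 1) + 1) k).edgeFinset with v ∈ e, (∑ z ∈ e, x z - x v) =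
      ∑ i ∈ Finset.range m with v ∈ Finset.Icc (i * (k - 1)) ((i + 1) * (k - 1)),
        (∑ z ∈ Finset.Icc (i * (k - 1)) ((i + 1) * (k - 1)), x z - x v) := by
  symm
  refine Finset.sum_bij (fun i _ => Finset.Icc (i * (k - 1)) ((i + 1) * (k - 1))) ?_ ?_ ?_ ?_
  · intro i hi
    rw [Finset.mem_filter, Finset.mem_range] at hi
    exact Finset.mem_filter.2 ⟨(mem_edgeFinset_hyperpath hk).2 ⟨i, hi.1, rfl⟩, hi.2⟩
  · intro i _ j _ hij
    have h1 : i * (k - 1) ∈ Finset.Icc (j * (k - 1)) ((j + 1) * (k - 1)) := by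
      rw [← hij]; exact Finset.left_mem_Icc.2 (Nat.mul_le_mul_right _ (by omega))
    have h2 : j * (k - 1) ∈ Finset.Icc (i * (k - 1)) ((i + 1) * (k - 1)) := by
      rw [hij]; exact Finset.left_mem_Icc.2 (Nat.mul_le_mul_right _ (by omega))
    rw [Finset.mem_Icc] at h1 h2
    exact le_antisymm (Nat.le_of_mul_le_mul_right h2.1 (by omega))
      (Nat.le_of_mul_le_mul_right h1.1 (by omega))
  · intro e he
    obtain ⟨he, hv⟩ := Finset.mem_filter.1 he
    obtain ⟨i, hi, rfl⟩ := (mem_edgeFinset_hyperpath hk).1 he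
    exact ⟨i, Finset.mem_filter.2 ⟨Finset.mem_range.2 hi, hv⟩, rfl⟩
  · intro i _
    rfl

/-- A positive eigenvector of a hyperpath is described by its profile. -/
theorem exists_pathProfile {m k : ℕ} (hk : 2 ≤ k) {lam : ℝ} {x : ℕ → ℝ} (hlam : 0 ≤ lam)
    (hpos : ∀ v ∈ (hyperpath (m * (k - 1) + 1) k).vertexSet, 0 < x v)
    (heq : ∀ v ∈ (hyperpath (m * (k - 1) + 1) k).vertexSet,
      ∑ e ∈ (hyperpath (m * (k - 1) + 1) k).edgeFinset with v ∈ e, (∑ z ∈ e, x z - x v) =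
        lam * x v) :
    ∃ b w T, PathProfile m ((k : ℝ) - 2) (lam + 1) b w T := by
  obtain ⟨d, rfl⟩ : ∃ d, k = d + 2 := Nat.exists_eq_add_of_le' hk
  simp only [sum_edges_hyperpath hk, show d + 2 - 1 = d + 1 by omega] at heq hpos
  have hV : ∀ v ≤ m * (d + 1), v ∈ (hyperpath (m * (d + 1) + 1) (d + 2)).vertexSet :=
    fun v hv => Nat.lt_succ_iff.2 hv
  set S : ℕ → ℝ := fun i => ∑ z ∈ Finset.Icc (i * (d + 1)) ((i + 1) * (d + 1)), x z with hS
  have hle : ∀ j ≤ m, j * (d + 1) ≤ m * (d + 1) := fun j hj => Nat.mul_le_mul_right _ hj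
  have hL : 0 < lam + 1 := by linarith
  have hcut : ∀ j ≤ m, (if j < m then S j - x (j * (d + 1)) else 0) +
      (if 0 < j then S (j - 1) - x (j * (d + 1)) else 0) = lam * x (j * (d + 1)) := by
    intro j hj
    rw [← heq _ (hV _ (hle j hj))]
    have hmem : ∀ i, j * (d + 1) ∈ Finset.Icc (i * (d + 1)) ((i + 1) * (d + 1)) ↔
        i = j ∨ i + 1 = j := by
      intro i
      rw [Finset.mem_Icc, Nat.mul_le_mul_right_iff (by omega), Nat.mul_le_mul_right_iff (by omega)]
      omega
    simp only [hmem]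
    have hfil : (Finset.range m).filter (fun i => i = j ∨ i + 1 = j) =
        (if j < m then {j} else ∅) ∪ (if 0 < j then {j - 1} else ∅) := by
      ext i
      grind
    rw [hfil, Finset.sum_union]
    · congr 1 <;> split_ifs <;> simp [hS]
    · rw [Finset.disjoint_left]
      grind
  -- A vertex inside edge i lies in no other edge, so S i - x z = lam · x z.
  have hint : ∀ i < m, ∀ z ∈ Finset.Ioo (i * (d + 1)) ((i + 1) * (d + 1)),
      x z = S i / (lam + 1) := by
    intro i hi z hz
    rw [Finset.mem_Ioo] at hz
    have h := heq z (hV z (hz.2.le.trans (hle _ hi)))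
    have hfil : (Finset.range m).filter
        (fun j => z ∈ Finset.Icc (j * (d + 1)) ((j + 1) * (d + 1))) = {i} := by
      ext j
      simp only [Finset.mem_filter, Finset.mem_range, Finset.mem_Icc, Finset.mem_singleton]
      constructor
      · rintro ⟨_, h1, h2⟩
        have h3 : j < i + 1 := Nat.lt_of_mul_lt_mul_right (h1.trans_lt hz.2)
        have h4 : i < j + 1 := Nat.lt_of_mul_lt_mul_right (hz.1.trans_le h2)
        omega
      · rintro rfl
        exact ⟨hi, hz.1.le, hz.2.le⟩
    rw [hfil, Finset.sum_singleton] at h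
    rw [eq_div_iff hL.ne']
    linarith
  have hSw : ∀ i < m, S i = x (i * (d + 1)) + x ((i + 1) * (d + 1)) + d * (S i / (lam + 1)) := by
    intro i hi
    have hlt : i * (d + 1) < (i + 1) * (d + 1) := Nat.mul_lt_mul_of_pos_right (by omega) (by omega)
    have h1 : S i = x ((i + 1) * (d + 1)) + (x (i * (d + 1)) +
        ∑ z ∈ Finset.Ioo (i * (d + 1)) ((i + 1) * (d + 1)), x z) := by
      rw [hS]
      simp only
      rw [← Finset.Ico_insert_right hlt.le, Finset.sum_insert (by simp),
        ← Finset.Ioo_insert_left hlt, Finset.sum_insert (by simp)]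
    rw [Finset.sum_congr rfl (hint i hi), Finset.sum_const, Nat.card_Ioo, nsmul_eq_mul,
      show (i + 1) * (d + 1) - i * (d + 1) - 1 = d by rw [add_mul, one_mul]; omega] at h1
    linarith
  have hSpos : ∀ i < m, 0 < S i := by
    intro i hi
    refine Finset.sum_pos (fun z hz => hpos z (hV z ?_)) ?_
    · exact (Finset.mem_Icc.1 hz).2.trans (hle _ hi)
    · exact ⟨_, Finset.left_mem_Icc.2 (Nat.mul_le_mul_right _ (by omega))⟩
  have hwpos : ∀ j ≤ m, 0 < x (j * (d + 1)) := fun j hj => hpos _ (hV _ (hle j hj))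
  -- The factor b eliminates the d = k - 2 inner vertices of an edge. The end values of T equal the
  -- end entries, so that the vertex equation also holds at the ends.
  refine ⟨1 - d / (lam + 1), fun j => x (j * (d + 1)),
    fun j => if j = 0 then x 0 else if j ≤ m then S (j - 1) else x (m * (d + 1)),
    ?_, hL, ?_, hwpos, ?_, ?_, ?_, ?_, ?_⟩
  · push_cast
    have : (0 : ℝ) ≤ d := Nat.cast_nonneg d
    linarith
  · push_cast
    field_simp
    ring
  · intro j hj
    split_ifs with h1 h2
    · simpa using hwpos 0 (by omega)
    · exact hSpos _ (by omega)
    · exact hwpos m le_rfl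
  · simp
  · simp
  · intro j hj
    have := hcut j hj
    by_cases h0 : j = 0
    · subst h0
      by_cases hm : m = 0
      · subst hm
        simp only [lt_self_iff_false, if_false, zero_mul, add_zero] at this
        simp only [zero_add, if_true, one_ne_zero, if_false, zero_mul, nonpos_iff_eq_zero]
        linarith
      · simp [show 0 < m by omega, show 1 ≤ m by omega] at this ⊢
        linarith
    · by_cases hm : j = m
      · subst hm
        simp [h0, show 0 < j by omega] at this ⊢
        linarith
      · simp [h0, hj, show 0 < j by omega, show j < m by omega, show j + 1 ≤ m by omega] at this ⊢
        linarith
  · intro j hj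
    have := hSw j hj
    simp only [Nat.add_eq_zero_iff, one_ne_zero, and_false, if_false, show j + 1 ≤ m from hj,
      if_true, Nat.add_sub_cancel]
    linear_combination -this

end Hypergraph

/-! ### The comparison theorem -/

theorem theorem1p3 {α : Type*} (G : Hypergraph α) [Fintype G.vertexSet] (n k : ℕ) (hk : 3 ≤ k)
    (hn : Fintype.card G.vertexSet = n) (hunif : G.IsUniform k) (htree : G.IsSupertree) :
    (Hypergraph.hyperpath n k).rho ≤ G.rho ∧
      ((Hypergraph.hyperpath n k).rho = G.rho ↔
        G.IsIsomorphic (Hypergraph.hyperpath n k)) := by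
  classical
  subst hn
  have key : G.rho ≤ (Hypergraph.hyperpath (Fintype.card G.vertexSet) k).rho →
      G.IsIsomorphic (Hypergraph.hyperpath (Fintype.card G.vertexSet) k) := by
    intro hle
    have hk2 : 2 ≤ k := by omega
    have hT := htree.isHypertree hunif
    have hcard : Fintype.card G.vertexSet = G.edgeFinset.card * (k - 1) + 1 := by
      rw [← hT.card_vertices hk2, Hypergraph.vertexFinset, Set.toFinset_card]
    obtain ⟨lamP, x, hlamP, hx, hxeq, hrhoP⟩ :=
      (Hypergraph.hyperpath_isUniform (m := G.edgeFinset.card) hk2).exists_perron hk2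
        ⟨0, by show 0 < _ + 1; omega⟩ fun _ hx _ hy => Hypergraph.hyperpath_reflTransGen hk2 hx hy
    obtain ⟨lamG, y, hlamG, hy, hyeq, hrhoG⟩ := hunif.exists_perron hk2 htree.nonempty
      fun _ hx _ hy => htree.connected.reflTransGen hx hy
    have hk' : (0 : ℝ) < (k : ℝ) - 1 := by
      have : (3 : ℝ) ≤ k := by exact_mod_cast hk
      linarith
    have hlam : lamG ≤ lamP := by
      have hrhoP' : (Hypergraph.hyperpath (Fintype.card G.vertexSet) k).rho =
          ENNReal.ofReal (lamP / ((k : ℝ) - 1)) := by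
        have : ∀ N, N = G.edgeFinset.card * (k - 1) + 1 → (Hypergraph.hyperpath N k).rho =
            ENNReal.ofReal (lamP / ((k : ℝ) - 1)) := by
          rintro _ rfl
          exact hrhoP
        exact this _ hcard
      rw [hrhoG, hrhoP', ENNReal.ofReal_le_ofReal_iff (by positivity),
        div_le_div_iff_of_pos_right hk'] at hle
      exact hle
    obtain ⟨b, w, T, hprof⟩ := Hypergraph.exists_pathProfile hk2 hlamP hx
      (fun v hv => by convert hxeq v hv)
    have hy' : ∀ u ∈ G.vertexFinset, 0 < y u := fun u hu =>
      hy u (Hypergraph.mem_vertexFinset.1 hu)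
    -- The only use of ρ(G) ≤ ρ(P): the eigenvector of G satisfies the vertex inequalities with the
    -- eigenvalue of the path.
    have hyle : ∀ u ∈ G.vertexFinset, ∑ e ∈ G.edgeFinset with u ∈ e, (∑ z ∈ e, y z - y u) ≤
        (lamP + 1 - 1) * y u := by
      intro u hu
      rw [hyeq u (Hypergraph.mem_vertexFinset.1 hu), add_sub_cancel_right]
      exact mul_le_mul_of_nonneg_right hlam (hy' u hu).le
    obtain ⟨q, v, e, hp, hE, hV⟩ := hT.exists_edgePath_cover hk2
      (fun _ _ h₁ _ h₂ _ h₃ m₁ m₂ m₃ n₁ n₂ n₃ => hprof.not_branching_vertex hT hk2 (by ring) rfl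
        hy' hyle h₁ h₂ h₃ m₁ m₂ m₃ n₁ n₂ n₃)
      (fun _ he _ m₁ _ m₂ _ m₃ n₁ n₂ n₃ hd => hprof.not_branching_edge hT hk2 (by ring) rfl
        hy' hyle he m₁ m₂ m₃ n₁ n₂ n₃ hd)
    exact Hypergraph.isIsomorphic_hyperpath_of_edgePath hk2 hT hp hE hV
  refine ⟨?_, fun h => key h.ge, fun h => h.rho_eq.symm⟩
  rcases le_total (Hypergraph.hyperpath (Fintype.card G.vertexSet) k).rho G.rho with h | h
  · exact h
  · exact (key h).rho_eq.ge
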